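/- Let $M$ be a compact, connected smooth manifold (without boundary) of dimension $m$ with a smooth Riemannian metric $g$ and volume density $|dV_g|$. Let $\boldsymbol V\subset C^\infty(M)$ be a vector subspace of finite dimension $N\geq 1$ with a Euclidean inner product $h$, and suppose that $\boldsymbol V$ is ample: for every $x\in M$ the linear map $\mathcal A_x:\boldsymbol V\to T_x^*M$, $\mathcal A_x v=d_xv$, is surjective. For $v\in\boldsymbol V$ let $\mu(v)\in\{0,1,2,\dots,\infty\}$ be the number of critical points of $v$, let $S(\boldsymbol V)$ be the unit sphere of $(\boldsymbol V,h)$ with area density $|dS_h|$, and set $$\mu(M,g,\boldsymbol V,h):=\frac{1}{\mathrm{area}(S(\boldsymbol V))}\int_{S(\boldsymbol V)}\mu(v)\,|dS_h(v)|.$$ For $x\in M$ let $\boldsymbol K_x=\ker\mathcal A_x$ be the space of all $v\in\boldsymbol V$ that have $x$ as a critical point, with the inner product induced by $h$ and unit sphere $S(\boldsymbol K_x)$. For $v\in\boldsymbol K_x$ let $\mathrm{Hess}_x(v,g):T_xM\to T_xM$ be the operator which represents the Hessian of $v$ at $x$ with respect to $g$, and set $$\Delta_x(\boldsymbol V,g):=\int_{S(\boldsymbol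 K_x)}|\det\mathrm{Hess}_x(v,g)|\,|dS(v)|.$$ Let $\mathcal A_x^\dagger:T_xM\to\boldsymbol V$ be the dual adjunction map, defined by $h(\mathcal A_x^\dagger X,v)=d_xv(X)$ for all $v\in\boldsymbol V$ (the differential at $x$ of the evaluation map $M\to\mathrm{Hom}(\boldsymbol V,\mathbb R)\cong\boldsymbol V$), and let $J(\mathcal A_x^\dagger,g,h)=\det\big(h(\mathcal A_x^\dagger e_i,\mathcal A_x^\dagger e_j)\big)^{1/2}$ be its Jacobian, where $(e_i)$ is a $g$-orthonormal basis of $T_xM$. Let $\sigma_{N-1}=2\pi^{N/2}/\Gamma(N/2)$ be the area of the unit sphere of dimension $N-1$. Then $v\mapsto\mu(v)$ is measurable with respect to the area measure on $S(\boldsymbol V)$ (up to null sets), the function $x\mapsto\Delta_x(\boldsymbol V,g)/J(\mathcal A_x^\dagger,g,h)$ is integrable on $M$, and $$\mu(M,g,\boldsymbol V,h)=\frac{1}{\sigma_{N-1}}\int_M\frac{\Delta_x(\boldsymbol V,g)}{J(\mathcal A_x^\dagger,g,h)}\,|dV_g(x)|.$$ In particular $\mu(M,g,\boldsymbol V,h)$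 is finite. Moreover, suppose that $(M,g,\boldsymbol V,h)$ is homogeneous with respect to a compact Lie group $G$, that is, $G$ acts smoothly, transitively and isometrically on $M$, the pullback of every function in $\boldsymbol V$ by every element of $G$ is again in $\boldsymbol V$, and $h$ is invariant under these pullbacks. Then $x\mapsto\Delta_x(\boldsymbol V,g)/J(\mathcal A_x^\dagger,g,h)$ is constant on $M$, and for every $x_0\in M$ $$\mu(M,g,\boldsymbol V,h)=\frac{\Delta_{x_0}(\boldsymbol V,g)}{\sigma_{N-1}\,J(\mathcal A_{x_0}^\dagger,g,h)}\cdot\mathrm{vol}_g(M).$$ -/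

import Mathlib

open MeasureTheory Bundle Metric
open scoped Manifold ContDiff ENNReal InnerProductSpace

noncomputable section

namespace CriticalSets

/-! ### Linear algebra in Euclidean spaces -/

section Euclidean

variable {E F : Type*} [NormedAddCommGroup E] [InnerProductSpace ℝ E] [FiniteDimensional ℝ E]
  [NormedAddCommGroup F] [InnerProductSpace ℝ F]

/-- The Jacobian of a linear map `A : E → F` between Euclidean spaces with `dim E ≤ dim F`: the
square root of the determinant of the Gram matrix `⟪A eᵢ, A eⱼ⟫`, for an orthonormal basis `e`
of `E`. -/
def jacobian (A : E →ₗ[ℝ] F) : ℝ :=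
  √(Matrix.gram ℝ fun i => A (stdOrthonormalBasis ℝ E i)).det

theorem jacobian_eq {ι : Type*} [Fintype ι] [DecidableEq ι] (b : OrthonormalBasis ι ℝ E)
    [FiniteDimensional ℝ F] (A : E →ₗ[ℝ] F) :
    jacobian A = √(Matrix.gram ℝ fun i => A (b i)).det := by
  have hb : (Matrix.gram ℝ fun i => A (b i)).det = LinearMap.det (LinearMap.adjoint A ∘ₗ A) := by
    rw [← LinearMap.det_toMatrix b.toBasis]
    congr 1
    ext i j
    simp [LinearMap.toMatrix_apply, b.repr_apply_apply, LinearMap.adjoint_inner_right]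
  have hs : (Matrix.gram ℝ fun i => A (stdOrthonormalBasis ℝ E i)).det =
      LinearMap.det (LinearMap.adjoint A ∘ₗ A) := by
    rw [← LinearMap.det_toMatrix (stdOrthonormalBasis ℝ E).toBasis]
    congr 1
    ext i j
    simp [LinearMap.toMatrix_apply, OrthonormalBasis.repr_apply_apply,
      LinearMap.adjoint_inner_right]
  rw [jacobian, hs, hb]

/-- The linear operator `T` on the Euclidean space `E` that represents the bilinear form `B`, that
is, `⟪T X, Y⟫ = B X Y`. -/
def operatorOfBilin (B : E →L[ℝ] E →L[ℝ] ℝ) : E →L[ℝ] E :=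
  haveI : CompleteSpace E := FiniteDimensional.complete ℝ E
  InnerProductSpace.continuousLinearMapOfBilin (𝕜 := ℝ) B

theorem inner_operatorOfBilin (B : E →L[ℝ] E →L[ℝ] ℝ) (X Y : E) :
    ⟪operatorOfBilin B X, Y⟫_ℝ = B X Y := by
  have : CompleteSpace E := FiniteDimensional.complete ℝ E
  exact InnerProductSpace.continuousLinearMapOfBilin_apply (𝕜 := ℝ) B X Y

/-- The area measure on the unit sphere of a Euclidean space `E`. It is normalized by polar
coordinates, so the total area is `n • vol (unit ball)`, where `n = dim E`; for `n = 1` it is the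
counting measure on two points. -/
def sphereArea (E : Type*) [NormedAddCommGroup E] [InnerProductSpace ℝ E] [FiniteDimensional ℝ E]
    [MeasurableSpace E] [BorelSpace E] : Measure (sphere (0 : E) 1) :=
  (volume : Measure E).toSphere

/-- The area `σₙ = 2 π ^ ((n + 1) / 2) / Γ ((n + 1) / 2)` of the round unit sphere of
dimension `n`. -/
def sigma (n : ℕ) : ℝ :=
  2 * Real.pi ^ (((n : ℝ) + 1) / 2) / Real.Gamma (((n : ℝ) + 1) / 2)

end Euclidean

variable {m : ℕ} {M : Type*} [TopologicalSpace M] [ChartedSpace (EuclideanSpace ℝ (Fin m)) M]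

instance instFiniteDimensionalTangentSpace (x : M) :
    FiniteDimensional ℝ (TangentSpace (𝓡 m) x) :=
  inferInstanceAs (FiniteDimensional ℝ (EuclideanSpace ℝ (Fin m)))

/-! ### The Riemannian volume -/

section Volume

variable [RiemannianBundle (fun x : M => TangentSpace (𝓡 m) x)]

/-- The coordinate vector field `∂ᵢ` of the preferred chart at `x`, at the point with
coordinates `y`. -/
def coordVector (x : M) (y : EuclideanSpace ℝ (Fin m)) (i : Fin m) :
    TangentSpace (𝓡 m) ((chartAt (EuclideanSpace ℝ (Fin m)) x).symm y) :=
  mfderiv (𝓡 m) (𝓡 m) (chartAt (EuclideanSpace ℝ (Fin m)) x).symm y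
    (EuclideanSpace.single i (1 : ℝ) : EuclideanSpace ℝ (Fin m))

/-- The volume density `√(det (g (∂ᵢ, ∂ⱼ)))` in the coordinates of the preferred chart at `x`. -/
def volumeDensity (x : M) (y : EuclideanSpace ℝ (Fin m)) : ℝ :=
  √(Matrix.gram ℝ (coordVector x y)).det

variable [MeasurableSpace M]

/-- The Riemannian volume `√(det g) dy¹ ⋯ dyᵐ` on the domain of the preferred chart at `x`,
extended by zero to `M`. -/
def chartVolume (x : M) : Measure M :=
  (((volume : Measure (EuclideanSpace ℝ (Fin m))).restrict
      (chartAt (EuclideanSpace ℝ (Fin m)) x).target).withDensity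
    fun y => ENNReal.ofReal (volumeDensity x y)).map
      (chartAt (EuclideanSpace ℝ (Fin m)) x).symm

/-- The Riemannian volume measure on `M`. By the change of variables formula the measures
`chartVolume x` agree on the overlaps of the charts, so their supremum in the lattice of measures
is the measure that restricts to `chartVolume x` on the domain of each chart. -/
def riemannianVolume (m : ℕ) (M : Type*) [TopologicalSpace M]
    [ChartedSpace (EuclideanSpace ℝ (Fin m)) M]
    [RiemannianBundle (fun x : M => TangentSpace (𝓡 m) x)] [MeasurableSpace M] : Measure M :=
  ⨆ x : M, chartVolume (m := m) x

end Volume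

/-! ### The sample space -/

/-- The space `V` of smooth functions on `M`, as a Euclidean space with the inner product `h`. -/
def SampleSpace (V : Submodule ℝ C^∞⟮𝓡 m, M; ℝ⟯) (_h : InnerProductSpace.Core ℝ V) : Type _ := V

namespace SampleSpace

variable (V : Submodule ℝ C^∞⟮𝓡 m, M; ℝ⟯) (h : InnerProductSpace.Core ℝ V)

instance instNormedAddCommGroup : NormedAddCommGroup (SampleSpace V h) :=
  h.toNormedAddCommGroup

instance instInnerProductSpace : InnerProductSpace ℝ (SampleSpace V h) :=
  InnerProductSpace.ofCore h.toCore

instance instFiniteDimensional [hV : FiniteDimensional ℝ V] :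
    FiniteDimensional ℝ (SampleSpace V h) := hV

instance instCompleteSpace [FiniteDimensional ℝ V] : CompleteSpace (SampleSpace V h) :=
  FiniteDimensional.complete ℝ _

instance instMeasurableSpace : MeasurableSpace (SampleSpace V h) := borel _

instance instBorelSpace : BorelSpace (SampleSpace V h) := ⟨rfl⟩

variable {V h}

/-- An element of the sample space, as a smooth function. -/
def toSmooth (v : SampleSpace V h) : C^∞⟮𝓡 m, M; ℝ⟯ := Subtype.val (show V from v)

instance instCoeFun : CoeFun (SampleSpace V h) fun _ => M → ℝ := ⟨fun v => v.toSmooth⟩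

theorem coe_add (u v : SampleSpace V h) : ((u + v : SampleSpace V h) : M → ℝ) = u + v := rfl

theorem coe_smul (c : ℝ) (v : SampleSpace V h) :
    ((c • v : SampleSpace V h) : M → ℝ) = c • (v : M → ℝ) := rfl

theorem inner_def (u v : SampleSpace V h) : ⟪u, v⟫_ℝ = h.inner u v := rfl

theorem mdifferentiableAt (v : SampleSpace V h) (x : M) :
    MDifferentiableAt (𝓡 m) 𝓘(ℝ, ℝ) (v : M → ℝ) x :=
  v.toSmooth.contMDiff.mdifferentiable (by simp) x

end SampleSpace

section Sample

variable {V : Submodule ℝ C^∞⟮𝓡 m, M; ℝ⟯} {h : InnerProductSpace.Core ℝ V}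

/-- The adjunction map `𝒜ₓ : V → T*ₓM`, `v ↦ dₓv`. -/
def adjunction (x : M) : SampleSpace V h →ₗ[ℝ] (TangentSpace (𝓡 m) x →L[ℝ] ℝ) where
  toFun v := mvfderiv (𝓡 m) (v : M → ℝ) x
  map_add' u v := by
    rw [SampleSpace.coe_add]
    exact mvfderiv_add (u.mdifferentiableAt x) (v.mdifferentiableAt x)
  map_smul' c v := by
    rw [SampleSpace.coe_smul]
    exact const_smul_mfderiv (v.mdifferentiableAt x) c

/-- The set of critical points of `v`. -/
def criticalSet (v : SampleSpace V h) : Set M := {x | adjunction x v = 0}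

/-- The number of critical points of `v`, possibly infinite. -/
def criticalCount (v : SampleSpace V h) : ℝ≥0∞ := (criticalSet v).encard

variable (V h) in
/-- Ampleness: for every `x`, every covector at `x` is the differential at `x` of some `v ∈ V`. -/
def IsAmple : Prop :=
  ∀ x : M, Function.Surjective (adjunction (V := V) (h := h) x)

variable (V h) in
/-- The space `Kₓ` of all `v ∈ V` that have `x` as a critical point. -/
def kernelSpace (x : M) : Submodule ℝ (SampleSpace V h) := LinearMap.ker (adjunction x)

/-- The dual adjunction map `𝒜ₓ† : TₓM → V`, with the dual of `V` identified with `V` by the inner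
product `h`. It is the differential at `x` of the evaluation map `M → V* ≅ V`. -/
def dualAdjunction [FiniteDimensional ℝ V] (x : M) :
    TangentSpace (𝓡 m) x →ₗ[ℝ] SampleSpace V h where
  toFun X := (InnerProductSpace.toDual ℝ (SampleSpace V h)).symm
    (LinearMap.toContinuousLinearMap
      { toFun := fun v => adjunction x v X
        map_add' := fun u v => by simp
        map_smul' := fun c v => by simp })
  map_add' X Y := by
    rw [← map_add]
    congr 1
    ext v
    simp
  map_smul' c X := by
    refine ext_inner_right ℝ fun v => ?_
    rw [InnerProductSpace.toDual_symm_apply, RingHom.id_apply, real_inner_smul_left,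
      InnerProductSpace.toDual_symm_apply]
    simp

theorem inner_dualAdjunction [FiniteDimensional ℝ V] (x : M) (X : TangentSpace (𝓡 m) x)
    (v : SampleSpace V h) : ⟪dualAdjunction x X, v⟫_ℝ = adjunction x v X := by
  simp [dualAdjunction, InnerProductSpace.toDual_symm_apply]

end Sample

/-- The Hessian at `x` of a function `f` on `M`, computed in the preferred chart at `x`:
`Hessₓ(f)(X, Y) = ∑ᵢⱼ Xⁱ Yʲ ∂ᵢ∂ⱼf(x)`. If `x` is a critical point of `f` it does not depend on the
chart. -/
def hessian (f : M → ℝ) (x : M) :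
    TangentSpace (𝓡 m) x →L[ℝ] TangentSpace (𝓡 m) x →L[ℝ] ℝ :=
  let φ := chartAt (EuclideanSpace ℝ (Fin m)) x
  let D : TangentSpace (𝓡 m) x →L[ℝ] EuclideanSpace ℝ (Fin m) := mfderiv (𝓡 m) (𝓡 m) φ x
  let H : EuclideanSpace ℝ (Fin m) →L[ℝ] EuclideanSpace ℝ (Fin m) →L[ℝ] ℝ :=
    fderiv ℝ (fderiv ℝ (f ∘ φ.symm)) (φ x)
  (ContinuousLinearMap.precomp ℝ D).comp (H.comp D)

theorem hessian_apply (f : M → ℝ) (x : M) (X Y : TangentSpace (𝓡 m) x) :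
    hessian f x X Y =
      fderiv ℝ (fderiv ℝ (f ∘ (chartAt (EuclideanSpace ℝ (Fin m)) x).symm))
        (chartAt (EuclideanSpace ℝ (Fin m)) x x)
        (mfderiv (𝓡 m) (𝓡 m) (chartAt (EuclideanSpace ℝ (Fin m)) x) x X)
        (mfderiv (𝓡 m) (𝓡 m) (chartAt (EuclideanSpace ℝ (Fin m)) x) x Y) := rfl

section Main

variable (V : Submodule ℝ C^∞⟮𝓡 m, M; ℝ⟯) (h : InnerProductSpace.Core ℝ V)
  [FiniteDimensional ℝ V]

/-- The expected number of critical points of a random function on the unit sphere of `(V, h)`. -/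
def expectation : ℝ≥0∞ :=
  (∫⁻ v, criticalCount (v : SampleSpace V h) ∂(sphereArea (SampleSpace V h))) /
    sphereArea (SampleSpace V h) Set.univ

variable [RiemannianBundle (fun x : M => TangentSpace (𝓡 m) x)]

/-- The Hessian operator `Hessₓ(f, g) : TₓM → TₓM`. -/
def hessianOperator (f : M → ℝ) (x : M) : TangentSpace (𝓡 m) x →L[ℝ] TangentSpace (𝓡 m) x :=
  operatorOfBilin (hessian f x)

/-- `Δₓ(V, g)`, the integral of `|det Hessₓ(v, g)|` over the unit sphere of `Kₓ`. -/
def hessianAverage (x : M) : ℝ :=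
  ∫ v : sphere (0 : kernelSpace V h x) 1,
    |(hessianOperator (m := m) (v.1.1 : SampleSpace V h).toSmooth x).det| ∂(sphereArea (kernelSpace V h x))

/-- The integrand `Δₓ(V, g) / J(𝒜ₓ†, g, h)`. -/
def criticalDensity (x : M) : ℝ :=
  hessianAverage V h x / jacobian (dualAdjunction (V := V) (h := h) x)

end Main

/-- The quadruple `(M, g, V, h)` is homogeneous with respect to the group `G` acting on `M`: the
action is transitive and preserves the metric `g`, the pullback of a function in `V` by an element
of `G` is again in `V`, and `h` is invariant under these pullbacks. -/
structure IsHomogeneous [RiemannianBundle (fun x : M => TangentSpace (𝓡 m) x)]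
    (V : Submodule ℝ C^∞⟮𝓡 m, M; ℝ⟯) (h : InnerProductSpace.Core ℝ V)
    (G : Type*) [Group G] [MulAction G M] : Prop where
  transitive : ∀ x y : M, ∃ a : G, a • x = y
  isometric : ∀ (a : G) (x : M) (X Y : TangentSpace (𝓡 m) x),
    ⟪mfderiv (𝓡 m) (𝓡 m) (fun z : M => a • z) x X,
      mfderiv (𝓡 m) (𝓡 m) (fun z : M => a • z) x Y⟫_ℝ = ⟪X, Y⟫_ℝ
  pullback_mem : ∀ (a : G) (v : SampleSpace V h), ∃ w : SampleSpace V h, ∀ x, w x = v (a • x)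
  inner_pullback : ∀ (a : G) (u v u' v' : SampleSpace V h),
    (∀ x, u' x = u (a • x)) → (∀ x, v' x = v (a • x)) → ⟪u', v'⟫_ℝ = ⟪u, v⟫_ℝ

end CriticalSets

end

/-!
The argument is the Kac–Rice formula. In a chart, the critical points of `v` are the zeros of a
vector field `A y v` that is linear in `v` and, by ampleness, surjective in `v` for each `y`. Hence
`{(y, v) | A y v = 0}` is the graph of a map over `y` and the coordinate `w` of `v` in a fixed
kernel, and the number of zeros of `v` is the number of preimages of `v` under this
parametrization. The area formula turns its integral over the unit ball into an integral over `y`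
of `|det (∂A v)| / J`, where `v` runs over the unit ball of the kernel of `A y`. Numbers of zeros
are homogeneous of degree `0` in `v` and determinants of degree `m`, so polar coordinates replace
the balls by spheres. The powers of the chart's Jacobian cancel, so the local formulas glue by
compactness. An isometry of `M` that preserves `(V, h)` by pullback preserves every ingredient of
the density, so under a transitive action the density is constant.
-/

noncomputable section

namespace CriticalSets

/-! ### The area formula with multiplicity -/

section AreaFormula

open Set

theorem encard_iUnion_eq_tsum {α ι : Type*} [Countable ι] {s : ι → Set α}
    (hs : Pairwise (Function.onFun Disjoint s)) :
    ((⋃ i, s i).encard : ℝ≥0∞) = ∑' i, ((s i).encard : ℝ≥0∞) := by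
  let _ : MeasurableSpace α := ⊤
  have hcount (t : Set α) : Measure.count t = t.encard := Measure.count_apply trivial
  simp_rw [← hcount]
  exact measure_iUnion hs fun _ => trivial

theorem encard_inter_preimage_singleton_of_injOn {α β : Type*} {f : α → β} {s : Set α}
    (hf : InjOn f s) (y : β) :
    ((s ∩ f ⁻¹' {y}).encard : ℝ≥0∞) = (f '' s).indicator 1 y := by
  by_cases hy : y ∈ f '' s
  · obtain ⟨x, hx, rfl⟩ := hy
    have hfibre : s ∩ f ⁻¹' {f x} = {x} :=
      Subset.antisymm (fun z hz => hf hz.1 hx hz.2) (singleton_subset_iff.2 ⟨hx, rfl⟩)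
    simp [hfibre, mem_image_of_mem f hx]
  · have hfibre : s ∩ f ⁻¹' {y} = ∅ :=
      eq_empty_of_forall_notMem fun x hx => hy ⟨x, hx.1, hx.2⟩
    simp [hfibre, hy]

theorem encard_iUnion_inter_preimage_singleton {α β ι : Type*} [Countable ι] {f : α → β}
    {s : ι → Set α} (hs : Pairwise (Function.onFun Disjoint s)) (hf : ∀ i, InjOn f (s i)) (y : β) :
    (((⋃ i, s i) ∩ f ⁻¹' {y}).encard : ℝ≥0∞) = ∑' i, (f '' s i).indicator 1 y := by
  rw [iUnion_inter, encard_iUnion_eq_tsum fun i j hij =>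
    (hs hij).mono inter_subset_left inter_subset_left]
  exact tsum_congr fun i => encard_inter_preimage_singleton_of_injOn (hf i) y

variable {E : Type*} [NormedAddCommGroup E] [NormedSpace ℝ E] [FiniteDimensional ℝ E]

theorem exists_forall_injOn_of_approximatesLinearOn {A : E →L[ℝ] E} (hA : A.det ≠ 0) :
    ∃ r : NNReal, r ≠ 0 ∧ ∀ (f : E → E) (s : Set E), ApproximatesLinearOn f A s r → InjOn f s := by
  have : CompleteSpace E := FiniteDimensional.complete ℝ E
  obtain ⟨B, rfl⟩ : ∃ B : E ≃L[ℝ] E, (B : E →L[ℝ] E) = A :=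
    ⟨A.toContinuousLinearEquivOfDetNeZero hA, by ext; simp⟩
  rcases B.subsingleton_or_nnnorm_symm_pos with hE | hpos
  · exact ⟨1, one_ne_zero, fun f s _ => injOn_of_subsingleton f s⟩
  · refine ⟨‖(B.symm : E →L[ℝ] E)‖₊⁻¹ / 2, (half_pos (inv_pos.2 hpos)).ne', fun f s hf => ?_⟩
    exact hf.injOn (Or.inr (NNReal.half_lt_self (inv_pos.2 hpos).ne'))

variable [MeasurableSpace E] [BorelSpace E]

theorem exists_iUnion_injOn_of_det_fderiv_ne_zero {f : E → E} {s : Set E} (hs : MeasurableSet s)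
    (hf : ∀ x ∈ s, DifferentiableAt ℝ f x) (hdet : ∀ x ∈ s, (fderiv ℝ f x).det ≠ 0) :
    ∃ t : ℕ → Set E, Pairwise (Function.onFun Disjoint t) ∧ (∀ n, MeasurableSet (t n)) ∧
      (∀ n, InjOn f (t n)) ∧ ⋃ n, t n = s := by
  choose! r hr0 hr using fun (A : E →L[ℝ] E) (hA : A.det ≠ 0) =>
    exists_forall_injOn_of_approximatesLinearOn hA
  obtain ⟨t, A, htd, htm, hst, htA, hA⟩ :=
    exists_partition_approximatesLinearOn_of_hasFDerivWithinAt f s (fderiv ℝ f)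
      (fun x hx => (hf x hx).hasFDerivAt.hasFDerivWithinAt)
      (fun A => if A.det = 0 then 1 else r A) (fun A => by
        by_cases h0 : A.det = 0
        · simp only [h0, if_true, ne_eq, one_ne_zero, not_false_eq_true]
        · simpa only [h0, if_false] using hr0 A h0)
  refine ⟨fun n => s ∩ t n, fun i j hij => (htd hij).mono inter_subset_right inter_subset_right,
    fun n => hs.inter (htm n), fun n => ?_, by rw [← inter_iUnion, inter_eq_left.2 hst]⟩
  rcases s.eq_empty_or_nonempty with rfl | hne
  · simp
  · obtain ⟨y, hy, hAy⟩ := hA hne n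
    have h0 : (A n).det ≠ 0 := hAy ▸ hdet y hy
    exact hr (A n) h0 f _ (by simpa only [h0, if_false] using htA n)

variable (μ : Measure E) [μ.IsAddHaarMeasure]

theorem measurableSet_det_fderiv_eq_zero (f : E → E) :
    MeasurableSet {x | (fderiv ℝ f x).det = 0} := by
  have : CompleteSpace E := FiniteDimensional.complete ℝ E
  exact ContinuousLinearMap.continuous_det.measurable.comp (measurable_fderiv ℝ f)
    (measurableSet_singleton 0)

/-- By Sard's theorem the critical points do not contribute to almost every fibre. -/
theorem ae_inter_preimage_singleton_eq_sdiff {f : E → E} {s : Set E}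
    (hf : ∀ x ∈ s, DifferentiableAt ℝ f x) :
    ∀ᵐ y ∂μ, s ∩ f ⁻¹' {y} = (s \ {x | (fderiv ℝ f x).det = 0}) ∩ f ⁻¹' {y} := by
  have hnull : μ (f '' (s ∩ {x | (fderiv ℝ f x).det = 0})) = 0 :=
    addHaar_image_eq_zero_of_det_fderivWithin_eq_zero μ
      (fun x hx => (hf x hx.1).hasFDerivAt.hasFDerivWithinAt) fun x hx => hx.2
  filter_upwards [measure_eq_zero_iff_ae_notMem.1 hnull] with y hy
  exact Subset.antisymm (fun x hx => ⟨⟨hx.1, fun h0 => hy ⟨x, ⟨hx.1, h0⟩, hx.2⟩⟩, hx.2⟩)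
    (inter_subset_inter_left _ sdiff_subset)

theorem exists_ae_encard_fibre_eq_tsum_indicator {f : E → E} {s : Set E} (hs : MeasurableSet s)
    (hf : ∀ x ∈ s, DifferentiableAt ℝ f x) :
    ∃ t : ℕ → Set E, Pairwise (Function.onFun Disjoint t) ∧ (∀ n, MeasurableSet (t n)) ∧
      (∀ n, InjOn f (t n)) ∧ ⋃ n, t n = s \ {x | (fderiv ℝ f x).det = 0} ∧
      ∀ᵐ y ∂μ, ((s ∩ f ⁻¹' {y}).encard : ℝ≥0∞) = ∑' n, (f '' t n).indicator 1 y := by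
  obtain ⟨t, htd, htm, hinj, hts⟩ := exists_iUnion_injOn_of_det_fderiv_ne_zero
    (hs.diff (measurableSet_det_fderiv_eq_zero f)) (fun x hx => hf x hx.1) fun x hx => hx.2
  refine ⟨t, htd, htm, hinj, hts, ?_⟩
  filter_upwards [ae_inter_preimage_singleton_eq_sdiff μ hf] with y hy
  rw [hy, ← hts, encard_iUnion_inter_preimage_singleton htd hinj]

theorem measurableSet_image_of_differentiableAt {f : E → E} {t : Set E} (ht : MeasurableSet t)
    (hf : ∀ x ∈ t, DifferentiableAt ℝ f x) (hinj : InjOn f t) : MeasurableSet (f '' t) :=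
  measurable_image_of_fderivWithin ht
    (fun x hx => (hf x hx).hasFDerivAt.hasFDerivWithinAt) hinj

theorem aemeasurable_encard_inter_preimage_singleton {f : E → E} {s : Set E}
    (hs : MeasurableSet s) (hf : ∀ x ∈ s, DifferentiableAt ℝ f x) :
    AEMeasurable (fun y => ((s ∩ f ⁻¹' {y}).encard : ℝ≥0∞)) μ := by
  obtain ⟨t, -, htm, hinj, hts, hcount⟩ := exists_ae_encard_fibre_eq_tsum_indicator μ hs hf
  have hsub (n : ℕ) : t n ⊆ s := (subset_iUnion t n).trans (hts ▸ sdiff_subset)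
  exact ⟨_, Measurable.tsum fun n => measurable_one.indicator
    (measurableSet_image_of_differentiableAt (htm n) (fun x hx => hf x (hsub n hx)) (hinj n)),
    hcount⟩

theorem lintegral_encard_inter_preimage_singleton_mul {f : E → E} {s : Set E}
    (hs : MeasurableSet s) (hf : ∀ x ∈ s, DifferentiableAt ℝ f x) {g : E → ℝ≥0∞}
    (hg : Measurable g) :
    ∫⁻ y, ((s ∩ f ⁻¹' {y}).encard : ℝ≥0∞) * g y ∂μ =
      ∫⁻ x in s, ENNReal.ofReal |(fderiv ℝ f x).det| * g (f x) ∂μ := by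
  obtain ⟨t, htd, htm, hinj, hts, hcount⟩ := exists_ae_encard_fibre_eq_tsum_indicator μ hs hf
  have hsub (n : ℕ) : t n ⊆ s := (subset_iUnion t n).trans (hts ▸ sdiff_subset)
  have hft (n : ℕ) : MeasurableSet (f '' t n) :=
    measurableSet_image_of_differentiableAt (htm n) (fun x hx => hf x (hsub n hx)) (hinj n)
  calc ∫⁻ y, ((s ∩ f ⁻¹' {y}).encard : ℝ≥0∞) * g y ∂μ
      = ∫⁻ y, ∑' n, (f '' t n).indicator g y ∂μ := by
        refine lintegral_congr_ae ?_
        filter_upwards [hcount] with y hy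
        rw [hy, ← ENNReal.tsum_mul_right]
        refine tsum_congr fun n => ?_
        rw [← indicator_mul_left, Pi.one_def]
        simp only [one_mul]
    _ = ∑' n, ∫⁻ y in f '' t n, g y ∂μ := by
        rw [lintegral_tsum fun n => (hg.indicator (hft n)).aemeasurable]
        exact tsum_congr fun n => lintegral_indicator (hft n) g
    _ = ∑' n, ∫⁻ x in t n, ENNReal.ofReal |(fderiv ℝ f x).det| * g (f x) ∂μ :=
        tsum_congr fun n => lintegral_image_eq_lintegral_abs_det_fderiv_mul μ (htm n)
          (fun x hx => (hf x (hsub n hx)).hasFDerivAt.hasFDerivWithinAt) (hinj n) g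
    _ = ∫⁻ x in s \ {x | (fderiv ℝ f x).det = 0},
          ENNReal.ofReal |(fderiv ℝ f x).det| * g (f x) ∂μ := by
        rw [← lintegral_iUnion htm htd, hts]
    _ = ∫⁻ x in s, ENNReal.ofReal |(fderiv ℝ f x).det| * g (f x) ∂μ := by
        have hcrit := measurableSet_det_fderiv_eq_zero f
        rw [← lintegral_inter_add_sdiff _ s hcrit, setLIntegral_eq_zero (hs.inter hcrit), zero_add]
        rintro x ⟨-, hx : (fderiv ℝ f x).det = 0⟩
        simp only [hx, abs_zero, ENNReal.ofReal_zero, zero_mul, Pi.zero_apply]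

end AreaFormula

/-! ### Jacobians and integration along complementary subspaces -/

section Jacobian

variable {E E' F : Type*} [NormedAddCommGroup E] [InnerProductSpace ℝ E] [FiniteDimensional ℝ E]
  [NormedAddCommGroup E'] [InnerProductSpace ℝ E'] [FiniteDimensional ℝ E']
  [NormedAddCommGroup F] [InnerProductSpace ℝ F]

theorem sqrt_det_gram_eq_normDet {ι : Type*} [Fintype ι] [DecidableEq ι]
    (b : OrthonormalBasis ι ℝ E) (B : E →ₗ[ℝ] F) :
    √(Matrix.gram ℝ fun i => B (b i)).det = B.normDet := by
  rw [← B.normDet_sq_eq_det_gram b]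
  exact Real.sqrt_sq B.normDet_nonneg

theorem jacobian_eq_normDet (B : E →ₗ[ℝ] F) : jacobian B = B.normDet :=
  sqrt_det_gram_eq_normDet _ B

theorem jacobian_nonneg (B : E →ₗ[ℝ] F) : 0 ≤ jacobian B :=
  Real.sqrt_nonneg _

theorem normDet_linearEquiv_pos (D : E ≃ₗ[ℝ] F) : 0 < (D : E →ₗ[ℝ] F).normDet :=
  (LinearMap.normDet_nonneg _).lt_of_ne'
    (((D : E →ₗ[ℝ] F).normDet_ne_zero_tfae.out 0 1).2 D.ker)

theorem normDet_linearIsometry_comp {H : Type*} [NormedAddCommGroup H] [InnerProductSpace ℝ H]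
    (S : H →ₗᵢ[ℝ] F) (B : E →ₗ[ℝ] H) :
    (S.toLinearMap ∘ₗ B).normDet = B.normDet := by
  have hS : (S.toLinearMap.domRestrict B.range).normDet = 1 :=
    (S.comp B.range.subtypeₗᵢ).normDet_eq_one
  rw [LinearMap.normDet_comp, hS, one_mul]

theorem det_adjoint (T : E →ₗ[ℝ] E) : LinearMap.det T.adjoint = LinearMap.det T := by
  rw [← LinearMap.det_toMatrix (stdOrthonormalBasis ℝ E).toBasis,
    ← LinearMap.det_toMatrix (stdOrthonormalBasis ℝ E).toBasis, LinearMap.toMatrix_adjoint,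
    Matrix.det_conjTranspose, star_trivial]

theorem det_adjoint_comp_comp (D : E ≃ₗ[ℝ] E') (T : E' →ₗ[ℝ] E') :
    LinearMap.det ((D : E →ₗ[ℝ] E').adjoint ∘ₗ T ∘ₗ (D : E →ₗ[ℝ] E')) =
      (D : E →ₗ[ℝ] E').normDet ^ 2 * LinearMap.det T := by
  have hconj : (D : E →ₗ[ℝ] E').adjoint ∘ₗ T ∘ₗ (D : E →ₗ[ℝ] E') =
      ((D : E →ₗ[ℝ] E').adjoint ∘ₗ (D : E →ₗ[ℝ] E')) ∘ₗ
        ((D.symm : E' →ₗ[ℝ] E) ∘ₗ T ∘ₗ (D.symm.symm : E →ₗ[ℝ] E')) := by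
    ext v
    simp
  rw [hconj, LinearMap.det_comp, LinearMap.det_conj, ← LinearMap.normDet_sq]
  rfl

variable [FiniteDimensional ℝ F]

theorem exists_linearIsometry_range_eq_orthogonal_ker {A : F →ₗ[ℝ] E}
    (hA : Function.Surjective A) :
    ∃ S : E →ₗᵢ[ℝ] F, LinearMap.range S.toLinearMap = (LinearMap.ker A)ᗮ := by
  have hrank : Module.finrank ℝ E = Module.finrank ℝ (LinearMap.ker A)ᗮ := by
    rw [LinearMap.orthogonal_ker, LinearMap.finrank_range_adjoint, LinearMap.range_eq_top.2 hA,
      finrank_top]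
  let e : E ≃ₗᵢ[ℝ] (LinearMap.ker A)ᗮ :=
    (stdOrthonormalBasis ℝ E).equiv (stdOrthonormalBasis ℝ (LinearMap.ker A)ᗮ) (finCongr hrank)
  refine ⟨(LinearMap.ker A)ᗮ.subtypeₗᵢ.comp e.toLinearIsometry, ?_⟩
  ext v
  exact ⟨by rintro ⟨x, rfl⟩; exact (e x).2, fun hv => ⟨e.symm ⟨v, hv⟩, by simp⟩⟩

theorem normDet_adjoint_eq_abs_det (A : F →ₗ[ℝ] E) (S : E →ₗᵢ[ℝ] F)
    (hS : LinearMap.range S.toLinearMap = (LinearMap.ker A)ᗮ) :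
    A.adjoint.normDet = |LinearMap.det (A ∘ₗ S.toLinearMap)| := by
  have hproj : A.adjoint = S.toLinearMap ∘ₗ (A ∘ₗ S.toLinearMap).adjoint := by
    ext x
    obtain ⟨p, hp⟩ : A.adjoint x ∈ LinearMap.range S.toLinearMap := by
      rw [hS, LinearMap.orthogonal_ker]
      exact LinearMap.mem_range_self _ x
    have hSp : S.toLinearMap.adjoint (S.toLinearMap p) = p :=
      ext_inner_right ℝ fun q => by
        rw [LinearMap.adjoint_inner_left]
        exact S.inner_map_map p q
    rw [LinearMap.adjoint_comp, LinearMap.comp_apply, LinearMap.comp_apply, ← hp, hSp]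
  rw [hproj, normDet_linearIsometry_comp, LinearMap.normDet_eq_abs_det, det_adjoint]

theorem normDet_adjoint_pos {A : F →ₗ[ℝ] E} (hA : Function.Surjective A) :
    0 < A.adjoint.normDet := by
  refine (LinearMap.normDet_nonneg _).lt_of_ne' ((A.adjoint.normDet_ne_zero_tfae.out 0 1).2 ?_)
  rw [← LinearMap.orthogonal_range, LinearMap.range_eq_top.2 hA, Submodule.top_orthogonal_eq_bot]

variable [MeasurableSpace E] [BorelSpace E] [MeasurableSpace F] [BorelSpace F]

theorem lintegral_comp_linearMap {f : E → ℝ≥0∞} (hf : Measurable f) (T : E →ₗ[ℝ] E)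
    (hT : LinearMap.det T ≠ 0) :
    ∫⁻ p, f (T p) = ENNReal.ofReal |LinearMap.det T|⁻¹ * ∫⁻ p, f p := by
  rw [← lintegral_map hf T.continuous_of_finiteDimensional.measurable,
    Measure.map_linearMap_addHaar_eq_smul_addHaar _ hT, lintegral_smul_measure, smul_eq_mul,
    abs_inv]

theorem exists_measurePreserving_add_orthogonal (K : Submodule ℝ F) (S : E →ₗᵢ[ℝ] F)
    (hS : LinearMap.range S.toLinearMap = Kᗮ) :
    ∃ e : E × K ≃ᵐ F, MeasurePreserving e ∧ ∀ z, e z = S z.1 + z.2 := by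
  let u : E ≃ₗᵢ[ℝ] Kᗮ := S.equivRange.trans (LinearIsometryEquiv.ofEq _ _ hS)
  let e : E × K ≃ᵐ F := MeasurableEquiv.prodComm.trans <|
    ((MeasurableEquiv.refl K).prodCongr u.toMeasurableEquiv).trans <|
      (MeasurableEquiv.toLp 2 (K × Kᗮ)).trans K.orthogonalDecomposition.symm.toMeasurableEquiv
  have he : MeasurePreserving e :=
    K.orthogonalDecomposition.symm.measurePreserving.comp <|
      (WithLp.volume_preserving_toLp K Kᗮ).comp <|
        ((MeasurePreserving.id volume).prod u.measurePreserving).comp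
          Measure.measurePreserving_swap
  exact ⟨e, he, fun z => add_comm (z.2 : F) (S z.1)⟩

theorem lintegral_eq_lintegral_orthogonal (K : Submodule ℝ F) (S : E →ₗᵢ[ℝ] F)
    (hS : LinearMap.range S.toLinearMap = Kᗮ) {f : F → ℝ≥0∞} (hf : Measurable f) :
    ∫⁻ v, f v = ∫⁻ p : E, ∫⁻ w : K, f (S p + w) := by
  obtain ⟨e, he, heq⟩ := exists_measurePreserving_add_orthogonal K S hS
  rw [← he.lintegral_comp hf, Measure.volume_eq_prod,
    lintegral_prod (fun z => f (e z)) (hf.comp e.measurable).aemeasurable]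
  simp only [heq]

theorem lintegral_eq_lintegral_ker_of_rightInverse (A : F →ₗ[ℝ] E) (s : E →ₗ[ℝ] F)
    (hs : ∀ p, A (s p) = p) {f : F → ℝ≥0∞} (hf : Measurable f) :
    ∫⁻ v, f v =
      ENNReal.ofReal A.adjoint.normDet⁻¹ * ∫⁻ p : E, ∫⁻ k : LinearMap.ker A, f (s p + k) := by
  have hA : Function.Surjective A := Function.RightInverse.surjective hs
  obtain ⟨S, hS⟩ := exists_linearIsometry_range_eq_orthogonal_ker hA
  have hdet : LinearMap.det (A ∘ₗ S.toLinearMap) ≠ 0 :=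
    abs_pos.1 (normDet_adjoint_eq_abs_det A S hS ▸ normDet_adjoint_pos hA)
  have hint : Measurable fun p : E => ∫⁻ k : LinearMap.ker A, f (s p + k) := by
    have hjoint : Measurable fun z : E × LinearMap.ker A => f (s z.1 + z.2) :=
      hf.comp ((s.continuous_of_finiteDimensional.measurable.comp measurable_fst).add
        (measurable_subtype_coe.comp measurable_snd))
    exact hjoint.lintegral_prod_right
  rw [lintegral_eq_lintegral_orthogonal (LinearMap.ker A) S hS hf,
    normDet_adjoint_eq_abs_det A S hS, ← lintegral_comp_linearMap hint _ hdet]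
  refine lintegral_congr fun p => ?_
  have hker : S p - s (A (S p)) ∈ LinearMap.ker A := by
    rw [LinearMap.mem_ker, map_sub, hs, sub_self]
  rw [← lintegral_add_left_eq_self (fun k : LinearMap.ker A => f (s _ + k))
    ⟨S p - s (A (S p)), hker⟩]
  refine lintegral_congr fun k => congrArg f ?_
  change S p + (k : F) = s (A (S p)) + (S p - s (A (S p)) + k)
  abel

theorem lintegral_eq_lintegral_orthogonal_shear (K : Submodule ℝ F) (R : E →ₗᵢ[ℝ] F)
    (hR : LinearMap.range R.toLinearMap = Kᗮ) (T : E →ₗ[ℝ] E) (hT : LinearMap.det T ≠ 0)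
    (c : K → E) {f : F → ℝ≥0∞} (hf : Measurable f) :
    ∫⁻ v, f v =
      ENNReal.ofReal |LinearMap.det T| * ∫⁻ w : K, ∫⁻ q : E, f (R (T q + c w) + w) := by
  have hjoint : Measurable fun z : E × K => f (R z.1 + z.2) :=
    hf.comp ((R.continuous.measurable.comp measurable_fst).add
      (measurable_subtype_coe.comp measurable_snd))
  have hslice (w : K) : ENNReal.ofReal |LinearMap.det T| * ∫⁻ q : E, f (R (T q + c w) + w) =
      ∫⁻ p : E, f (R p + w) := by
    have hw : Measurable fun p : E => f (R p + w) := hjoint.comp measurable_prodMk_right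
    have hcomp := lintegral_comp_linearMap (hw.comp (measurable_add_const (c w))) T hT
    simp only [Function.comp_apply] at hcomp
    rw [hcomp, ← mul_assoc, ← ENNReal.ofReal_mul (abs_nonneg _), mul_inv_cancel₀ (abs_ne_zero.2 hT),
      ENNReal.ofReal_one, one_mul]
    exact lintegral_add_right_eq_self (fun p => f (R p + w)) (c w)
  rw [lintegral_eq_lintegral_orthogonal K R hR hf, lintegral_lintegral_swap hjoint.aemeasurable,
    ← lintegral_const_mul' _ _ ENNReal.ofReal_ne_top]
  exact lintegral_congr fun w => (hslice w).symm

theorem lintegral_mul_comp_sub_rightInverse (A : F →ₗ[ℝ] E) (s : E →ₗ[ℝ] F)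
    (hs : ∀ p, A (s p) = p) {χ : E → ℝ≥0∞} (hχ : Measurable χ) {g : F → ℝ≥0∞}
    (hg : Measurable g) :
    ∫⁻ v, χ (A v) * g (v - s (A v)) =
      ENNReal.ofReal A.adjoint.normDet⁻¹ * ((∫⁻ p, χ p) * ∫⁻ k : LinearMap.ker A, g k) := by
  have hAm : Measurable A := A.continuous_of_finiteDimensional.measurable
  have hsm : Measurable s := s.continuous_of_finiteDimensional.measurable
  have hI : Measurable fun v => χ (A v) * g (v - s (A v)) :=
    (hχ.comp hAm).mul (hg.comp (measurable_id.sub (hsm.comp hAm)))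
  rw [lintegral_eq_lintegral_ker_of_rightInverse A s hs hI, ← lintegral_mul_const _ hχ]
  refine congrArg _ (lintegral_congr fun p => ?_)
  have hgk : Measurable fun k : LinearMap.ker A => g k := hg.comp measurable_subtype_coe
  rw [← lintegral_const_mul _ hgk]
  refine lintegral_congr fun k => ?_
  have hAk : A (s p + k) = p := by rw [map_add, LinearMap.mem_ker.1 k.2, add_zero, hs]
  rw [hAk, add_sub_cancel_left]

theorem lintegral_mul_comp_sub_of_orthogonal (A : F →ₗ[ℝ] E) (K : Submodule ℝ F) (R : E →ₗᵢ[ℝ] F)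
    (hR : LinearMap.range R.toLinearMap = Kᗮ) (T : E →ₗ[ℝ] E) (hT : ∀ p, A (R (T p)) = p)
    {χ : E → ℝ≥0∞} (hχ : Measurable χ) {g : F → ℝ≥0∞} (hg : Measurable g) :
    ∫⁻ v, χ (A v) * g (v - R (T (A v))) =
      ENNReal.ofReal |LinearMap.det T| * ((∫⁻ p, χ p) * ∫⁻ w : K, g (w - R (T (A w)))) := by
  have hdetT : LinearMap.det T ≠ 0 := right_ne_zero_of_mul_eq_one <| by
    rw [← LinearMap.det_comp, (LinearMap.ext hT : (A ∘ₗ R.toLinearMap) ∘ₗ T = LinearMap.id),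
      LinearMap.det_id]
  have hQ : Measurable fun v => v - R (T (A v)) :=
    (ContinuousLinearMap.id ℝ F - R.toContinuousLinearMap.comp
      (LinearMap.toContinuousLinearMap (T ∘ₗ A))).continuous.measurable
  have hgQ : Measurable fun w : K => g (w - R (T (A w))) :=
    hg.comp (hQ.comp measurable_subtype_coe)
  have hI : Measurable fun v => χ (A v) * g (v - R (T (A v))) :=
    (hχ.comp A.continuous_of_finiteDimensional.measurable).mul (hg.comp hQ)
  rw [lintegral_eq_lintegral_orthogonal_shear K R hR T hdetT (fun w => -T (A w)) hI,
    ← lintegral_const_mul _ hgQ]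
  refine congrArg _ (lintegral_congr fun w => ?_)
  rw [← lintegral_mul_const _ hχ]
  refine lintegral_congr fun q => ?_
  have hA : A (R (T q + -T (A w)) + w) = q := by
    simp only [map_add, map_neg, hT, neg_add_cancel_right]
  have hq : R (T q + -T (A w)) + w - R (T q) = w - R (T (A w)) := by
    rw [map_add, map_neg]
    abel
  rw [hA, hq]

/-- The oblique projection `w ↦ w - R (A R)⁻¹ A w` from `K` onto `ker A` multiplies volumes by
`J(A†) / |det (A R)|`; this is read off by computing the integral over `F` of
`1_{ball} (A v) * g (v - R (A R)⁻¹ A v)` in two ways. -/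
theorem lintegral_oblique_projection (A : F →ₗ[ℝ] E) (K : Submodule ℝ F) (R : E →ₗᵢ[ℝ] F)
    (hR : LinearMap.range R.toLinearMap = Kᗮ) (T : E →ₗ[ℝ] E) (hT : ∀ p, A (R (T p)) = p)
    {g : F → ℝ≥0∞} (hg : Measurable g) :
    ENNReal.ofReal |LinearMap.det T| * ∫⁻ w : K, g (w - R (T (A w))) =
      ENNReal.ofReal A.adjoint.normDet⁻¹ * ∫⁻ k : LinearMap.ker A, g k := by
  let χ : E → ℝ≥0∞ := (ball (0 : E) 1).indicator 1
  have hχ : Measurable χ := measurable_one.indicator measurableSet_ball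
  have hball : ∫⁻ p, χ p = volume (ball (0 : E) 1) := lintegral_indicator_one measurableSet_ball
  have hball_pos : ∫⁻ p, χ p ≠ 0 := hball ▸ (measure_ball_pos volume (0 : E) one_pos).ne'
  have hball_top : ∫⁻ p, χ p ≠ ⊤ := hball ▸ measure_ball_lt_top.ne
  have hK := lintegral_mul_comp_sub_of_orthogonal A K R hR T hT hχ hg
  have hker := lintegral_mul_comp_sub_rightInverse A (R.toLinearMap ∘ₗ T) hT hχ hg
  rw [← ENNReal.mul_right_inj hball_pos hball_top, mul_left_comm, ← hK, mul_left_comm, ← hker]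
  rfl

end Jacobian

/-! ### The zeros of a random vector field -/

/-- The family `Z` of subsets of `X`, parametrized by the measure space `(Θ, P)`, has the intensity
`ρ` with respect to `μ` on the set `W`: the expected number of points of `Z θ` in `W` is finite and
equal to the integral of `ρ` over `W`. -/
structure HasIntensityOn {Θ X : Type*} [MeasurableSpace Θ] [MeasurableSpace X] (P : Measure Θ)
    (μ : Measure X) (Z : Θ → Set X) (ρ : X → ℝ≥0∞) (W : Set X) : Prop where
  aemeasurable_encard : AEMeasurable (fun θ => ((W ∩ Z θ).encard : ℝ≥0∞)) P
  lintegral_encard : ∫⁻ θ, (W ∩ Z θ).encard ∂P = ∫⁻ x in W, ρ x ∂μ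
  aemeasurable_density : AEMeasurable ρ (μ.restrict W)
  lintegral_density_lt_top : ∫⁻ x in W, ρ x ∂μ < ⊤

instance instIsAddHaarMeasureVolumeProd {X Y : Type*} [AddGroup X] [TopologicalSpace X]
    [IsTopologicalAddGroup X] [AddGroup Y] [TopologicalSpace Y] [IsTopologicalAddGroup Y]
    [MeasureSpace X] [MeasureSpace Y] [MeasurableAdd X] [MeasurableAdd Y]
    [SFinite (volume : Measure X)] [SFinite (volume : Measure Y)]
    [(volume : Measure X).IsAddHaarMeasure] [(volume : Measure Y).IsAddHaarMeasure] :
    (volume : Measure (X × Y)).IsAddHaarMeasure :=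
  inferInstanceAs ((volume : Measure X).prod (volume : Measure Y)).IsAddHaarMeasure

theorem continuousLinearMap_det_prod_snd {E F : Type*} [NormedAddCommGroup E] [NormedSpace ℝ E]
    [FiniteDimensional ℝ E] [NormedAddCommGroup F] [NormedSpace ℝ F] [FiniteDimensional ℝ F]
    (L : E × F →L[ℝ] E) :
    (L.prod (ContinuousLinearMap.snd ℝ E F)).det =
      (L.comp (ContinuousLinearMap.inl ℝ E F)).det := by
  let b := Module.finBasis ℝ E
  let c := Module.finBasis ℝ F
  have hblocks : LinearMap.toMatrix (b.prod c) (b.prod c)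
      (L.prod (ContinuousLinearMap.snd ℝ E F) : E × F →ₗ[ℝ] E × F) =
      Matrix.fromBlocks
        (LinearMap.toMatrix b b (L.comp (ContinuousLinearMap.inl ℝ E F) : E →ₗ[ℝ] E))
        (LinearMap.toMatrix c b (L.comp (ContinuousLinearMap.inr ℝ E F) : F →ₗ[ℝ] E)) 0 1 := by
    ext i j
    rcases i with i | i <;> rcases j with j | j <;>
      simp [LinearMap.toMatrix_apply, Matrix.one_apply, Finsupp.single_apply, eq_comm]
  rw [ContinuousLinearMap.det, ContinuousLinearMap.det, ← LinearMap.det_toMatrix (b.prod c),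
    ← LinearMap.det_toMatrix b, hblocks, Matrix.det_fromBlocks_zero₂₁, Matrix.det_one, mul_one]

theorem abs_det_neg {E : Type*} [AddCommGroup E] [Module ℝ E] (T : E →ₗ[ℝ] E) :
    |LinearMap.det (-T)| = |LinearMap.det T| := by
  rw [← neg_one_smul ℝ T, LinearMap.det_smul, abs_mul, abs_neg_one_pow, one_mul]

section GraphSolution

variable {E F : Type*} [NormedAddCommGroup E] [InnerProductSpace ℝ E]
  [NormedAddCommGroup F] [InnerProductSpace ℝ F]

/-- The solution `p` of the equation `A y (R p + w) = 0`, where `z = (y, w)`; it is meaningful when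
`A y ∘ R` is invertible. -/
def graphSolution (A : E → F →L[ℝ] E) (R : E →ₗᵢ[ℝ] F) (K : Submodule ℝ F) (z : E × K) : E :=
  -((A z.1).comp R.toContinuousLinearMap).inverse (A z.1 z.2)

/-- The change of variables `(y, w) ↦ (p, w)`, where `p` solves `A y (R p + w) = 0`. -/
def graphMap (A : E → F →L[ℝ] E) (R : E →ₗᵢ[ℝ] F) (K : Submodule ℝ F) (z : E × K) : E × K :=
  (graphSolution A R K z, z.2)

variable {A : E → F →L[ℝ] E} {R : E →ₗᵢ[ℝ] F} {K : Submodule ℝ F} {U : Set E} {y : E}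

theorem apply_add_eq_zero_iff_graphSolution_eq
    (hy : ((A y).comp R.toContinuousLinearMap).IsInvertible) (w : K) (p : E) :
    A y (R p + w) = 0 ↔ graphSolution A R K (y, w) = p := by
  rw [graphSolution, neg_eq_iff_eq_neg, hy.inverse_apply_eq, map_neg, map_add, add_comm,
    add_eq_zero_iff_eq_neg]
  rfl

theorem encard_zeros_eq_encard_fibre {W : Set E}
    (hinv : ∀ x ∈ W, ((A x).comp R.toContinuousLinearMap).IsInvertible) (z : E × K) :
    (W ∩ {x | A x (R z.1 + z.2) = 0}).encard =
      ((W ×ˢ Set.univ) ∩ graphMap A R K ⁻¹' {z}).encard := by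
  obtain ⟨p, w⟩ := z
  rw [← (Prod.mk_left_injective w).encard_image]
  congr 1
  ext ⟨x, w'⟩
  simp only [graphMap, Set.mem_image, Set.mem_ofPred_eq, Prod.mk.injEq, Set.mem_inter_iff,
    Set.mem_prod, Set.mem_univ, and_true, Set.mem_preimage, Set.mem_singleton_iff]
  constructor
  · rintro ⟨x, ⟨hx, hzero⟩, rfl, rfl⟩
    exact ⟨hx, (apply_add_eq_zero_iff_graphSolution_eq (hinv x hx) w p).1 hzero, rfl⟩
  · rintro ⟨hx, hsol, rfl⟩
    exact ⟨x, ⟨hx, (apply_add_eq_zero_iff_graphSolution_eq (hinv x hx) w' p).2 hsol⟩, rfl, rfl⟩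

theorem norm_le_norm_add_of_range_eq_orthogonal (hR : LinearMap.range R.toLinearMap = Kᗮ) (p : E)
    (w : K) : ‖w‖ ≤ ‖R p + (w : F)‖ := by
  have horth : ⟪R p, (w : F)⟫_ℝ = 0 :=
    Submodule.inner_left_of_mem_orthogonal w.2 (hR ▸ LinearMap.mem_range_self R.toLinearMap p)
  have hsq := norm_add_sq_eq_norm_sq_add_norm_sq_real horth
  rw [Submodule.coe_norm]
  nlinarith [mul_self_nonneg ‖R p‖, norm_nonneg (R p + (w : F))]

variable [FiniteDimensional ℝ E]

theorem isInvertible_comp_of_range_eq_orthogonal_ker {B : F →L[ℝ] E}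
    (hR : LinearMap.range R.toLinearMap = (LinearMap.ker (B : F →ₗ[ℝ] E))ᗮ) :
    (B.comp R.toContinuousLinearMap).IsInvertible := by
  have hinj : Function.Injective (B.comp R.toContinuousLinearMap : E →ₗ[ℝ] E) := by
    refine LinearMap.ker_eq_bot.1 (LinearMap.ker_eq_bot'.2 fun p hp => ?_)
    have hker : R p ∈ LinearMap.ker (B : F →ₗ[ℝ] E) := hp
    have horth : R p ∈ (LinearMap.ker (B : F →ₗ[ℝ] E))ᗮ :=
      hR ▸ LinearMap.mem_range_self R.toLinearMap p
    have hzero : R p = 0 :=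
      inner_self_eq_zero.1 (Submodule.inner_right_of_mem_orthogonal hker horth)
    exact R.injective (hzero.trans (map_zero R).symm)
  exact ⟨(LinearEquiv.ofInjectiveEndo _ hinj).toContinuousLinearEquiv, rfl⟩

theorem contDiffAt_graphSolution (hA : ContDiffAt ℝ 1 A y)
    (hy : ((A y).comp R.toContinuousLinearMap).IsInvertible) (w : K) :
    ContDiffAt ℝ 1 (graphSolution A R K) (y, w) := by
  have : CompleteSpace E := FiniteDimensional.complete ℝ E
  have hA' : ContDiffAt ℝ 1 (fun z : E × K => A z.1) (y, w) :=
    ContDiffAt.comp (y, w) (f := Prod.fst) (g := A) hA contDiffAt_fst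
  have hw : ContDiffAt ℝ 1 (fun z : E × K => ((z.2 : K) : F)) (y, w) :=
    K.subtypeL.contDiff.contDiffAt.comp _ contDiffAt_snd
  have hinv : ContDiffAt ℝ 1
      (fun z : E × K => ((A z.1).comp R.toContinuousLinearMap).inverse) (y, w) :=
    ContDiffAt.comp (y, w) (g := ContinuousLinearMap.inverse) hy.contDiffAt_map_inverse
      (hA'.clm_comp contDiffAt_const)
  exact (hinv.clm_apply (hA'.clm_apply hw)).neg

theorem fderiv_graphSolution_comp_inl (hU : IsOpen U) (hA : ContDiffOn ℝ 1 A U)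
    (hinv : ∀ x ∈ U, ((A x).comp R.toContinuousLinearMap).IsInvertible) (hy : y ∈ U) (w : K) :
    (fderiv ℝ (graphSolution A R K) (y, w)).comp (ContinuousLinearMap.inl ℝ E K) =
      -((A y).comp R.toContinuousLinearMap).inverse.comp
        ((fderiv ℝ A y).flip (R (graphSolution A R K (y, w)) + w)) := by
  let D := (fderiv ℝ (graphSolution A R K) (y, w)).comp (ContinuousLinearMap.inl ℝ E K)
  have hAy : ContDiffAt ℝ 1 A y := hA.contDiffAt (hU.mem_nhds hy)
  have hG : HasFDerivAt (fun x => graphSolution A R K (x, w)) D y :=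
    HasFDerivAt.comp (f := fun x => (x, w)) y
      ((contDiffAt_graphSolution hAy (hinv y hy) w).differentiableAt one_ne_zero).hasFDerivAt
      (hasFDerivAt_prodMk_left y w)
  have hzero : (fun x => A x (R (graphSolution A R K (x, w)) + (w : F))) =ᶠ[nhds y]
      fun _ => 0 := by
    filter_upwards [hU.mem_nhds hy] with x hx
      using (apply_add_eq_zero_iff_graphSolution_eq (hinv x hx) w _).2 rfl
  have hderiv := ((hAy.differentiableAt one_ne_zero).hasFDerivAt.clm_apply
    ((R.toContinuousLinearMap.hasFDerivAt.comp y hG).add_const (w : F))).unique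
      ((hasFDerivAt_const (0 : E) y).congr_of_eventuallyEq hzero)
  ext u
  refine ((hinv y hy).inverse_apply_eq.2 (neg_eq_of_add_eq_zero_left
    (DFunLike.congr_fun hderiv u))).symm.trans ?_
  exact map_neg _ _

theorem hasFDerivAt_graphMap (hU : IsOpen U) (hA : ContDiffOn ℝ 1 A U)
    (hinv : ∀ x ∈ U, ((A x).comp R.toContinuousLinearMap).IsInvertible) {z : E × K}
    (hz : z.1 ∈ U) :
    HasFDerivAt (graphMap A R K)
      ((fderiv ℝ (graphSolution A R K) z).prod (ContinuousLinearMap.snd ℝ E K)) z :=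
  ((contDiffAt_graphSolution (hA.contDiffAt (hU.mem_nhds hz)) (hinv z.1 hz)
    z.2).differentiableAt one_ne_zero).hasFDerivAt.prodMk hasFDerivAt_snd

theorem abs_det_fderiv_graphMap [FiniteDimensional ℝ F] (hU : IsOpen U)
    (hA : ContDiffOn ℝ 1 A U)
    (hinv : ∀ x ∈ U, ((A x).comp R.toContinuousLinearMap).IsInvertible) (hy : y ∈ U) (w : K) :
    |(fderiv ℝ (graphMap A R K) (y, w)).det| =
      |((A y).comp R.toContinuousLinearMap).inverse.det| *
        |((fderiv ℝ A y).flip (R (graphSolution A R K (y, w)) + w)).det| := by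
  rw [(hasFDerivAt_graphMap hU hA hinv hy).fderiv,
    continuousLinearMap_det_prod_snd, fderiv_graphSolution_comp_inl hU hA hinv hy w]
  simp only [ContinuousLinearMap.det, ContinuousLinearMap.toLinearMap_neg,
    ContinuousLinearMap.toLinearMap_comp, ← LinearMap.neg_comp, LinearMap.det_comp, abs_mul,
    abs_det_neg]

/-- The intensity at `y` of the zeros of the random vector field `x ↦ A x v`, where `v` is
distributed according to the volume of the unit ball of `F`. -/
def zeroDensity [FiniteDimensional ℝ F] [MeasurableSpace F] [BorelSpace F] (A : E → F →L[ℝ] E)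
    (y : E) : ℝ≥0∞ :=
  ENNReal.ofReal (LinearMap.adjoint (A y : F →ₗ[ℝ] E)).normDet⁻¹ *
    ∫⁻ v in ball (0 : LinearMap.ker (A y : F →ₗ[ℝ] E)) 1,
      ENNReal.ofReal |((fderiv ℝ A y).flip (v : F)).det|

variable [FiniteDimensional ℝ F] [MeasurableSpace E] [BorelSpace E] [MeasurableSpace F]
  [BorelSpace F]

/-- The part of `v` in `K` is free and its part in the range of `R` is determined by the equation
`A y v = 0`, so that the fibre of the change of variables over `y` is a graph over `K`. -/
theorem lintegral_graphSolution_eq_zeroDensity (hU : IsOpen U) (hA : ContDiffOn ℝ 1 A U)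
    (hinv : ∀ x ∈ U, ((A x).comp R.toContinuousLinearMap).IsInvertible)
    (hR : LinearMap.range R.toLinearMap = Kᗮ) (hy : y ∈ U) :
    ∫⁻ w : K, ENNReal.ofReal
        |(fderiv ℝ (graphMap A R K) (y, w)).det| *
        (ball (0 : F) 1).indicator 1 (R (graphSolution A R K (y, w)) + w) = zeroDensity A y := by
  let δ : F → ℝ≥0∞ := fun v => ENNReal.ofReal |((fderiv ℝ A y).flip v).det|
  have hδ : Measurable δ := (ContinuousLinearMap.continuous_det.comp
    (fderiv ℝ A y).flip.continuous).abs.measurable.ennreal_ofReal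
  let g : F → ℝ≥0∞ := fun v => δ v * (ball (0 : F) 1).indicator 1 v
  have hg : Measurable g := hδ.mul (measurable_one.indicator measurableSet_ball)
  let T : E →L[ℝ] E := ((A y).comp R.toContinuousLinearMap).inverse
  have hT (p : E) : A y (R (T p)) = p := ((hinv y hy).inverse_apply_eq.1 rfl).symm
  have hsol (w : K) : R (graphSolution A R K (y, w)) + (w : F) = w - R (T (A y w)) := by
    rw [graphSolution, map_neg]
    exact neg_add_eq_sub _ _
  have hproj := lintegral_oblique_projection (A y : F →ₗ[ℝ] E) K R hR (T : E →ₗ[ℝ] E) hT hg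
  calc _ = ∫⁻ w : K, ENNReal.ofReal |T.det| * g (w - R (T (A y w))) :=
        lintegral_congr fun w => by
          rw [abs_det_fderiv_graphMap hU hA hinv hy w,
            ENNReal.ofReal_mul (abs_nonneg _), hsol, mul_assoc]
    _ = ENNReal.ofReal (LinearMap.adjoint (A y : F →ₗ[ℝ] E)).normDet⁻¹ *
          ∫⁻ v : LinearMap.ker (A y : F →ₗ[ℝ] E), g v := by
        rw [← hproj, ← lintegral_const_mul']
        · rfl
        · exact ENNReal.ofReal_ne_top
    _ = zeroDensity A y := by
        rw [zeroDensity, ← lintegral_indicator measurableSet_ball]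
        refine congrArg _ (lintegral_congr fun v => ?_)
        by_cases hv : v ∈ ball (0 : LinearMap.ker (A y : F →ₗ[ℝ] E)) 1
        · have hv' : (v : F) ∈ ball (0 : F) 1 := hv
          rw [Set.indicator_of_mem hv]
          simp only [g, Set.indicator_of_mem hv', Pi.one_apply, mul_one, δ]
        · have hv' : (v : F) ∉ ball (0 : F) 1 := hv
          rw [Set.indicator_of_notMem hv]
          simp only [g, Set.indicator_of_notMem hv', mul_zero]

theorem aemeasurable_encard_zeros (hU : IsOpen U) (hA : ContDiffOn ℝ 1 A U)
    (hinv : ∀ x ∈ U, ((A x).comp R.toContinuousLinearMap).IsInvertible)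
    (hR : LinearMap.range R.toLinearMap = Kᗮ) {W : Set E} (hWU : W ⊆ U) (hW : MeasurableSet W) :
    AEMeasurable (fun v => ((W ∩ {x | A x v = 0}).encard : ℝ≥0∞)) volume := by
  obtain ⟨e, he, heq⟩ := exists_measurePreserving_add_orthogonal K R hR
  have hfibre := aemeasurable_encard_inter_preimage_singleton volume
    (hW.prod (MeasurableSet.univ (α := K)))
    fun z hz => (hasFDerivAt_graphMap hU hA hinv (hWU hz.1)).differentiableAt
  rw [← he.aemeasurable_comp_iff e.measurableEmbedding]
  simpa only [Function.comp_def, ← encard_zeros_eq_encard_fibre fun x hx => hinv x (hWU hx),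
    ← heq] using hfibre

theorem restrict_prod_volume (W : Set E) :
    (volume.restrict W).prod (volume : Measure K) =
      (volume : Measure (E × K)).restrict (W ×ˢ Set.univ) := by
  rw [Measure.volume_eq_prod, ← Measure.prod_restrict, Measure.restrict_univ]

theorem aemeasurable_abs_det_fderiv_graphMap (hU : IsOpen U) (hA : ContDiffOn ℝ 1 A U)
    (hinv : ∀ x ∈ U, ((A x).comp R.toContinuousLinearMap).IsInvertible) {W : Set E} (hWU : W ⊆ U)
    (hW : MeasurableSet W) :
    AEMeasurable (fun z : E × K => ENNReal.ofReal |(fderiv ℝ (graphMap A R K) z).det| *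
      (ball (0 : F) 1).indicator 1 (R (graphSolution A R K z) + z.2))
      ((volume.restrict W).prod (volume : Measure K)) := by
  rw [restrict_prod_volume]
  refine AEMeasurable.mul (ContinuousLinearMap.continuous_det.measurable.comp
    (measurable_fderiv ℝ _)).abs.ennreal_ofReal.aemeasurable ?_
  refine (measurable_one.indicator measurableSet_ball).comp_aemeasurable ?_
  refine ContinuousOn.aemeasurable (fun z hz => ?_) (hW.prod MeasurableSet.univ)
  have hz : ContinuousAt (graphMap A R K) z :=
    (hasFDerivAt_graphMap hU hA hinv (hWU hz.1)).continuousAt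
  exact ((R.continuous.continuousAt.comp hz.fst).add
    (continuous_subtype_val.continuousAt.comp hz.snd)).continuousWithinAt

theorem aemeasurable_zeroDensity (hU : IsOpen U) (hA : ContDiffOn ℝ 1 A U)
    (hinv : ∀ x ∈ U, ((A x).comp R.toContinuousLinearMap).IsInvertible)
    (hR : LinearMap.range R.toLinearMap = Kᗮ) {W : Set E} (hWU : W ⊆ U) (hW : MeasurableSet W) :
    AEMeasurable (zeroDensity A) (volume.restrict W) := by
  refine (aemeasurable_abs_det_fderiv_graphMap (K := K) hU hA hinv hWU
    hW).lintegral_prod_right'.congr ?_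
  filter_upwards [ae_restrict_mem hW] with x hx
    using lintegral_graphSolution_eq_zeroDensity hU hA hinv hR (hWU hx)

theorem lintegral_encard_zeros (hU : IsOpen U) (hA : ContDiffOn ℝ 1 A U)
    (hinv : ∀ x ∈ U, ((A x).comp R.toContinuousLinearMap).IsInvertible)
    (hR : LinearMap.range R.toLinearMap = Kᗮ) {W : Set E} (hWU : W ⊆ U) (hW : MeasurableSet W) :
    ∫⁻ v in ball (0 : F) 1, (W ∩ {x | A x v = 0}).encard = ∫⁻ x in W, zeroDensity A x := by
  obtain ⟨e, he, heq⟩ := exists_measurePreserving_add_orthogonal K R hR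
  let χ : F → ℝ≥0∞ := (ball (0 : F) 1).indicator 1
  have hχ : Measurable χ := measurable_one.indicator measurableSet_ball
  calc ∫⁻ v in ball (0 : F) 1, (W ∩ {x | A x v = 0}).encard
      = ∫⁻ v, (W ∩ {x | A x v = 0}).encard * χ v := by
        rw [← lintegral_indicator measurableSet_ball]
        refine lintegral_congr fun v => ?_
        by_cases hv : v ∈ ball (0 : F) 1 <;> simp [χ, hv]
    _ = ∫⁻ z : E × K, ((W ×ˢ Set.univ) ∩ graphMap A R K ⁻¹' {z}).encard * χ (e z) := by
        rw [← he.lintegral_comp_emb e.measurableEmbedding]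
        simp only [← encard_zeros_eq_encard_fibre fun x hx => hinv x (hWU hx), ← heq]
    _ = ∫⁻ z in W ×ˢ (Set.univ : Set K),
          ENNReal.ofReal |(fderiv ℝ (graphMap A R K) z).det| * χ (e (graphMap A R K z)) :=
        lintegral_encard_inter_preimage_singleton_mul volume (hW.prod MeasurableSet.univ)
          (fun z hz => (hasFDerivAt_graphMap hU hA hinv (hWU hz.1)).differentiableAt)
          (hχ.comp e.measurable)
    _ = ∫⁻ x in W, ∫⁻ w : K, ENNReal.ofReal |(fderiv ℝ (graphMap A R K) (x, w)).det| *
          χ (R (graphSolution A R K (x, w)) + w) := by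
        simp only [heq]
        rw [← restrict_prod_volume]
        exact lintegral_prod _ (aemeasurable_abs_det_fderiv_graphMap hU hA hinv hWU hW)
    _ = ∫⁻ x in W, zeroDensity A x := setLIntegral_congr_fun hW fun x hx =>
        lintegral_graphSolution_eq_zeroDensity hU hA hinv hR (hWU hx)

theorem exists_forall_zeroDensity_le (hU : IsOpen U) (hA : ContDiffOn ℝ 1 A U)
    (hinv : ∀ x ∈ U, ((A x).comp R.toContinuousLinearMap).IsInvertible)
    (hR : LinearMap.range R.toLinearMap = Kᗮ) {C : Set E} (hCU : C ⊆ U) (hC : IsCompact C) :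
    ∃ b ≠ ⊤, ∀ x ∈ C, zeroDensity A x ≤ b := by
  have : ProperSpace K := FiniteDimensional.proper ℝ K
  have hcont : ContinuousOn (fun z => |(fderiv ℝ (graphMap A R K) z).det|)
      (C ×ˢ closedBall (0 : K) 1) := fun z hz => by
    have hG : ContDiffAt ℝ 1 (graphMap A R K) z :=
      (contDiffAt_graphSolution (hA.contDiffAt (hU.mem_nhds (hCU hz.1))) (hinv z.1 (hCU hz.1))
        z.2).prodMk contDiffAt_snd
    exact (ContinuousLinearMap.continuous_det.continuousAt.comp
      (hG.fderiv_right (m := 0) le_rfl).continuousAt).abs.continuousWithinAt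
  obtain ⟨b, hb⟩ := (hC.prod (isCompact_closedBall (0 : K) 1)).bddAbove_image hcont
  refine ⟨ENNReal.ofReal b * volume (closedBall (0 : K) 1),
    ENNReal.mul_ne_top ENNReal.ofReal_ne_top measure_closedBall_lt_top.ne, fun x hx => ?_⟩
  rw [← lintegral_graphSolution_eq_zeroDensity hU hA hinv hR (hCU hx), ← setLIntegral_const,
    ← lintegral_indicator measurableSet_closedBall]
  refine lintegral_mono fun w => ?_
  by_cases hw : R (graphSolution A R K (x, w)) + (w : F) ∈ ball (0 : F) 1
  · have hw' : w ∈ closedBall (0 : K) 1 := mem_closedBall_zero_iff.2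
      ((norm_le_norm_add_of_range_eq_orthogonal hR _ w).trans (mem_ball_zero_iff.1 hw).le)
    rw [Set.indicator_of_mem hw, Set.indicator_of_mem hw', Pi.one_apply, mul_one]
    exact ENNReal.ofReal_le_ofReal (hb ⟨(x, w), ⟨hx, hw'⟩, rfl⟩)
  · rw [Set.indicator_of_notMem hw, mul_zero]
    exact zero_le

theorem exists_ball_hasIntensityOn_zeros (hU : IsOpen U) (hA : ContDiffOn ℝ 1 A U) (hy : y ∈ U)
    (hAy : Function.Surjective (A y)) :
    ∃ r > 0, ball y r ⊆ U ∧ ∀ W ⊆ ball y r, MeasurableSet W →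
      HasIntensityOn (volume.restrict (ball (0 : F) 1)) volume (fun v => {x | A x v = 0})
        (zeroDensity A) W := by
  have : CompleteSpace E := FiniteDimensional.complete ℝ E
  obtain ⟨R, hR⟩ := exists_linearIsometry_range_eq_orthogonal_ker (A := (A y : F →ₗ[ℝ] E)) hAy
  let S : Set E := U ∩ {x | ((A x).comp R.toContinuousLinearMap).IsInvertible}
  have hS : IsOpen S := (hA.continuousOn.clm_comp continuousOn_const).isOpen_inter_preimage hU
    ContinuousLinearEquiv.isOpen
  have hyS : y ∈ S := ⟨hy, isInvertible_comp_of_range_eq_orthogonal_ker hR⟩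
  have hAS : ContDiffOn ℝ 1 A S := hA.mono Set.inter_subset_left
  have hinv : ∀ x ∈ S, ((A x).comp R.toContinuousLinearMap).IsInvertible := fun x hx => hx.2
  obtain ⟨r, hr, hrS⟩ := Metric.nhds_basis_closedBall.mem_iff.1 (hS.mem_nhds hyS)
  refine ⟨r, hr, ball_subset_closedBall.trans (hrS.trans Set.inter_subset_left),
    fun W hWr hW => ?_⟩
  have hWS : W ⊆ S := hWr.trans (ball_subset_closedBall.trans hrS)
  have : ProperSpace E := FiniteDimensional.proper ℝ E
  obtain ⟨b, hb, hle⟩ := exists_forall_zeroDensity_le hS hAS hinv hR hrS (isCompact_closedBall y r)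
  refine ⟨(aemeasurable_encard_zeros hS hAS hinv hR hWS hW).restrict,
    lintegral_encard_zeros hS hAS hinv hR hWS hW, aemeasurable_zeroDensity hS hAS hinv hR hWS hW,
    ?_⟩
  calc ∫⁻ x in W, zeroDensity A x ≤ ∫⁻ _ in W, b :=
        setLIntegral_mono' hW fun x hx => hle x (ball_subset_closedBall (hWr hx))
    _ = b * volume W := setLIntegral_const _ _
    _ < ⊤ := ENNReal.mul_lt_top hb.lt_top ((measure_mono hWr).trans_lt measure_ball_lt_top)

end GraphSolution

/-! ### Integration over the unit sphere -/

section Polar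

variable {E : Type*} [NormedAddCommGroup E] [InnerProductSpace ℝ E]

variable (E) in
/-- The measure `r ^ (n - 1) dr` on the radii `0 < r < 1` of the unit ball of `E`, where
`n = dim E`. -/
def radialMeasure : Measure (Set.Ioi (0 : ℝ)) :=
  (Measure.volumeIoiPow (Module.finrank ℝ E - 1)).restrict (Set.Iio ⟨1, Set.mem_Ioi.2 one_pos⟩)

instance : SFinite (radialMeasure E) := inferInstanceAs (SFinite (Measure.restrict _ _))

theorem lintegral_pow_radialMeasure [FiniteDimensional ℝ E] [Nontrivial E] (d : ℕ) :
    ∫⁻ r : Set.Ioi (0 : ℝ), ENNReal.ofReal (r.1 ^ d) ∂(radialMeasure E) =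
      ((Module.finrank ℝ E + d : ℕ) : ℝ≥0∞)⁻¹ := by
  have hdim : Module.finrank ℝ E - 1 + d + 1 = Module.finrank ℝ E + d := by
    have : 0 < Module.finrank ℝ E := Module.finrank_pos
    omega
  have hpow (k : ℕ) : Measurable fun r : Set.Ioi (0 : ℝ) => ENNReal.ofReal (r.1 ^ k) :=
    (measurable_subtype_coe.pow_const k).ennreal_ofReal
  have hball := Measure.volumeIoiPow_apply_Iio (Module.finrank ℝ E - 1 + d)
    ⟨1, Set.mem_Ioi.2 one_pos⟩
  rw [Measure.volumeIoiPow, withDensity_apply _ measurableSet_Iio] at hball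
  calc ∫⁻ r : Set.Ioi (0 : ℝ), ENNReal.ofReal (r.1 ^ d) ∂(radialMeasure E)
      = ∫⁻ r in Set.Iio (⟨1, Set.mem_Ioi.2 one_pos⟩ : Set.Ioi (0 : ℝ)),
          ENNReal.ofReal (r.1 ^ (Module.finrank ℝ E - 1 + d))
            ∂(Measure.comap Subtype.val volume) := by
        rw [radialMeasure, Measure.volumeIoiPow,
          setLIntegral_withDensity_eq_setLIntegral_mul _ (hpow _) (hpow d) measurableSet_Iio]
        refine lintegral_congr fun r => ?_
        rw [Pi.mul_apply, ← ENNReal.ofReal_mul (pow_nonneg r.2.le _), pow_add]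
    _ = ((Module.finrank ℝ E + d : ℕ) : ℝ≥0∞)⁻¹ := by
        rw [hball, one_pow, one_div, ENNReal.ofReal_inv_of_pos (by positivity), ← Nat.cast_succ,
          ENNReal.ofReal_natCast, Nat.succ_eq_add_one, hdim]

variable [FiniteDimensional ℝ E] [MeasurableSpace E] [BorelSpace E]

instance : IsFiniteMeasure (sphereArea E) := inferInstanceAs (IsFiniteMeasure (Measure.toSphere _))

theorem measurePreserving_polar [Nontrivial E] :
    MeasurePreserving (fun z : sphere (0 : E) 1 × Set.Ioi (0 : ℝ) => (z.2 : ℝ) • (z.1 : E))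
      ((sphereArea E).prod (radialMeasure E)) (volume.restrict (ball 0 1)) := by
  have hpunctured : (volume : Measure E).restrict {0}ᶜ = volume :=
    Measure.restrict_eq_self_of_ae_mem (compl_mem_ae_iff.2 (measure_singleton 0))
  have hpolar := (measurePreserving_subtype_coe (μa := (volume : Measure E))
    (measurableSet_singleton 0).compl).comp
    ((volume : Measure E).measurePreserving_homeomorphUnitSphereProd.symm
      (homeomorphUnitSphereProd E).toMeasurableEquiv)
  rw [hpunctured] at hpolar
  have hpreimage : (fun z : sphere (0 : E) 1 × Set.Ioi (0 : ℝ) => (z.2 : ℝ) • (z.1 : E)) ⁻¹'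
      ball 0 1 = Set.univ ×ˢ Set.Iio ⟨1, Set.mem_Ioi.2 one_pos⟩ := by
    ext z
    simp only [Set.mem_preimage, mem_ball_zero_iff, norm_smul, norm_eq_of_mem_sphere, mul_one,
      Real.norm_of_nonneg z.2.2.le, Set.mem_prod, Set.mem_univ, true_and, Set.mem_Iio]
    rfl
  have hball := hpolar.restrict_preimage (measurableSet_ball (x := (0 : E)) (ε := 1))
  rw [radialMeasure, sphereArea, ← Measure.restrict_univ (μ := Measure.toSphere _),
    Measure.prod_restrict, ← hpreimage]
  exact hball

section Homogeneous

variable [Nontrivial E] {d : ℕ} {φ : E → ℝ≥0∞}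

theorem aemeasurable_sphere_of_homogeneous
    (hφ : ∀ r : ℝ, 0 < r → ∀ v, φ (r • v) = ENNReal.ofReal (r ^ d) * φ v)
    (hm : AEMeasurable φ (volume.restrict (ball 0 1))) :
    AEMeasurable (fun s : sphere (0 : E) 1 => φ s) (sphereArea E) := by
  have hpolar : AEMeasurable
      (fun z : sphere (0 : E) 1 × Set.Ioi (0 : ℝ) => ENNReal.ofReal ((z.2 : ℝ) ^ d) * φ z.1)
      ((sphereArea E).prod (radialMeasure E)) :=
    (hm.comp_quasiMeasurePreserving measurePreserving_polar.quasiMeasurePreserving).congr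
      (Filter.Eventually.of_forall fun z => hφ _ z.2.2 _)
  obtain ⟨g, hg, hgφ⟩ :=
    hpolar.comp_quasiMeasurePreserving Measure.measurePreserving_swap.quasiMeasurePreserving
  have : NeZero (radialMeasure E) := by
    refine ⟨fun hzero => ?_⟩
    have hpow := lintegral_pow_radialMeasure (E := E) 0
    rw [hzero, lintegral_zero_measure] at hpow
    exact ENNReal.natCast_ne_top _ (ENNReal.inv_eq_zero.1 hpow.symm)
  obtain ⟨r, hr⟩ := (Measure.ae_ae_of_ae_prod hgφ).exists
  refine ⟨fun s => (ENNReal.ofReal ((r : ℝ) ^ d))⁻¹ * g (r, s),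
    (hg.comp measurable_prodMk_left).const_mul _, hr.mono fun s hs => ?_⟩
  have hpos : ENNReal.ofReal ((r : ℝ) ^ d) ≠ 0 :=
    (ENNReal.ofReal_pos.2 (pow_pos r.2 d)).ne'
  dsimp only
  rw [← hs, Function.comp_apply, Prod.swap_prod_mk,
    ENNReal.inv_mul_cancel_left hpos ENNReal.ofReal_ne_top]

theorem lintegral_sphere_of_homogeneous
    (hφ : ∀ r : ℝ, 0 < r → ∀ v, φ (r • v) = ENNReal.ofReal (r ^ d) * φ v)
    (hm : AEMeasurable φ (volume.restrict (ball 0 1))) :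
    ∫⁻ s : sphere (0 : E) 1, φ s ∂(sphereArea E) =
      ((Module.finrank ℝ E + d : ℕ) : ℝ≥0∞) * ∫⁻ v in ball (0 : E) 1, φ v := by
  have hradial : AEMeasurable (fun r : Set.Ioi (0 : ℝ) => ENNReal.ofReal ((r : ℝ) ^ d))
      (radialMeasure E) := (measurable_subtype_coe.pow_const d).ennreal_ofReal.aemeasurable
  have hball : ∫⁻ v in ball (0 : E) 1, φ v =
      (∫⁻ s : sphere (0 : E) 1, φ s ∂(sphereArea E)) *
        ((Module.finrank ℝ E + d : ℕ) : ℝ≥0∞)⁻¹ := by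
    rw [← lintegral_pow_radialMeasure,
      ← lintegral_prod_mul (aemeasurable_sphere_of_homogeneous hφ hm) hradial,
      ← measurePreserving_polar.map_eq, lintegral_map' (by rwa [measurePreserving_polar.map_eq])
        measurePreserving_polar.aemeasurable]
    exact lintegral_congr fun z => (hφ _ z.2.2 _).trans (mul_comm _ _)
  have hdim : ((Module.finrank ℝ E + d : ℕ) : ℝ≥0∞) ≠ 0 :=
    Nat.cast_ne_zero.2 (Nat.add_pos_left Module.finrank_pos d).ne'
  rw [hball, mul_left_comm, ENNReal.mul_inv_cancel hdim (ENNReal.natCast_ne_top _), mul_one]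

end Homogeneous

theorem lintegral_sphere_abs_det {G : Type*} [NormedAddCommGroup G] [NormedSpace ℝ G]
    [FiniteDimensional ℝ G] (L : E →L[ℝ] G →L[ℝ] G) :
    ∫⁻ s : sphere (0 : E) 1, ENNReal.ofReal |(L s).det| ∂(sphereArea E) =
      ((Module.finrank ℝ E + Module.finrank ℝ G : ℕ) : ℝ≥0∞) *
        ∫⁻ v in ball (0 : E) 1, ENNReal.ofReal |(L v).det| := by
  rcases subsingleton_or_nontrivial E with _ | _
  · have hdet (v : E) :
        (Module.finrank ℝ G : ℝ≥0∞) * ENNReal.ofReal |(L v).det| = 0 := by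
      rcases Nat.eq_zero_or_pos (Module.finrank ℝ G) with hG | hG
      · rw [hG, Nat.cast_zero, zero_mul]
      · rw [Subsingleton.elim v 0, map_zero, ContinuousLinearMap.det,
          ContinuousLinearMap.toLinearMap_zero, LinearMap.det_zero, zero_pow hG.ne', abs_zero,
          ENNReal.ofReal_zero, mul_zero]
    rw [lintegral_of_isEmpty, Module.finrank_zero_of_subsingleton, zero_add,
      ← lintegral_const_mul' _ _ (ENNReal.natCast_ne_top _)]
    simp only [hdet, lintegral_zero]
  · refine lintegral_sphere_of_homogeneous (φ := fun v => ENNReal.ofReal |(L v).det|)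
      (fun r hr v => ?_) ?_
    · rw [map_smul, ContinuousLinearMap.det, ContinuousLinearMap.toLinearMap_smul,
        LinearMap.det_smul, abs_mul,
        abs_of_pos (pow_pos hr _), ENNReal.ofReal_mul (pow_nonneg hr.le _)]
    · exact (ENNReal.continuous_ofReal.comp
        (ContinuousLinearMap.continuous_det.comp L.continuous).abs).aemeasurable

theorem sphereArea_univ [Nontrivial E] :
    sphereArea E Set.univ = ENNReal.ofReal (sigma (Module.finrank ℝ E - 1)) := by
  have hdim : 0 < Module.finrank ℝ E := Module.finrank_pos
  have : (0 : ℝ) < Module.finrank ℝ E := Nat.cast_pos.2 hdim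
  have hGamma : Real.Gamma ((Module.finrank ℝ E : ℝ) / 2) ≠ 0 :=
    (Real.Gamma_pos_of_pos (by positivity)).ne'
  rw [sphereArea, Measure.toSphere_apply_univ, InnerProductSpace.volume_ball,
    ENNReal.ofReal_one, one_pow, one_mul, ← ENNReal.ofReal_natCast,
    ← ENNReal.ofReal_mul (Nat.cast_nonneg _), sigma, Nat.cast_pred hdim, sub_add_cancel]
  congr 1
  rw [Real.Gamma_add_one (by positivity), Real.sqrt_eq_rpow, ← Real.rpow_mul_natCast
    Real.pi_pos.le, one_div_mul_eq_div]
  field_simp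

theorem sigma_pos (n : ℕ) : 0 < sigma n := by
  have := Real.Gamma_pos_of_pos (s := ((n : ℝ) + 1) / 2) (by positivity)
  have := Real.pi_pos
  rw [sigma]
  positivity

end Polar

/-! ### Differentials and Hessians in coordinates -/

theorem fderiv_fderiv_comp_of_fderiv_eq_zero {E F G : Type*} [NormedAddCommGroup E]
    [NormedSpace ℝ E] [NormedAddCommGroup F] [NormedSpace ℝ F] [NormedAddCommGroup G]
    [NormedSpace ℝ G] {u : F → G} {φ : E → F} {y : E} (hu : ContDiffAt ℝ 2 u (φ y))
    (hφ : ContDiffAt ℝ 2 φ y) (hcrit : fderiv ℝ u (φ y) = 0) (X Y : E) :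
    fderiv ℝ (fderiv ℝ (u ∘ φ)) y X Y =
      fderiv ℝ (fderiv ℝ u) (φ y) (fderiv ℝ φ y X) (fderiv ℝ φ y Y) := by
  have hchain : fderiv ℝ (u ∘ φ) =ᶠ[nhds y] fun x => (fderiv ℝ u (φ x)).comp (fderiv ℝ φ x) := by
    filter_upwards [hφ.continuousAt.eventually (hu.eventually (by simp)),
      hφ.eventually (by simp)] with x hux hφx
    exact fderiv_comp x (hux.differentiableAt two_ne_zero) (hφx.differentiableAt two_ne_zero)
  have hdu : HasFDerivAt (fun x => fderiv ℝ u (φ x))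
      ((fderiv ℝ (fderiv ℝ u) (φ y)).comp (fderiv ℝ φ y)) y :=
    ((hu.fderiv_right (m := 1) (by norm_num)).differentiableAt one_ne_zero).hasFDerivAt.comp y
      (hφ.differentiableAt two_ne_zero).hasFDerivAt
  have hdφ : HasFDerivAt (fderiv ℝ φ) (fderiv ℝ (fderiv ℝ φ) y) y :=
    ((hφ.fderiv_right (m := 1) (by norm_num)).differentiableAt one_ne_zero).hasFDerivAt
  rw [((hdu.clm_comp hdφ).congr_of_eventuallyEq hchain).fderiv]
  change fderiv ℝ u (φ y) (fderiv ℝ (fderiv ℝ φ) y X Y) +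
    fderiv ℝ (fderiv ℝ u) (φ y) (fderiv ℝ φ y X) (fderiv ℝ φ y Y) = _
  rw [hcrit, zero_apply, zero_add]

/-- The vector that represents a linear form on a Euclidean space. -/
def ofDual (E : Type*) [NormedAddCommGroup E] [InnerProductSpace ℝ E] [CompleteSpace E] :
    (E →L[ℝ] ℝ) →L[ℝ] E where
  toFun l := (InnerProductSpace.toDual ℝ E).symm l
  map_add' l l' := map_add _ l l'
  map_smul' c l := map_smulₛₗ (InnerProductSpace.toDual ℝ E).symm c l
  cont := (InnerProductSpace.toDual ℝ E).symm.continuous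

theorem inner_ofDual {E : Type*} [NormedAddCommGroup E] [InnerProductSpace ℝ E] [CompleteSpace E]
    (l : E →L[ℝ] ℝ) (X : E) : ⟪ofDual E l, X⟫_ℝ = l X :=
  InnerProductSpace.toDual_symm_apply

local notation:max "ℝ^" m:max => EuclideanSpace ℝ (Fin m)

section Manifold

variable {m : ℕ} {M : Type*} [TopologicalSpace M] [ChartedSpace ℝ^m M]

section Parametrization

variable {f : M → ℝ} {ψ : ℝ^m → M} {y : ℝ^m}

theorem contDiffAt_comp_of_contMDiffAt (hf : ContMDiff (𝓡 m) 𝓘(ℝ, ℝ) ∞ f)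
    (hψ : ContMDiffAt (𝓡 m) (𝓡 m) ∞ ψ y) : ContDiffAt ℝ ∞ (f ∘ ψ) y :=
  (hf.contMDiffAt.comp y hψ).contDiffAt

theorem fderiv_comp_eq_mvfderiv_comp (hf : ContMDiff (𝓡 m) 𝓘(ℝ, ℝ) ∞ f)
    (hψ : ContMDiffAt (𝓡 m) (𝓡 m) ∞ ψ y) :
    fderiv ℝ (f ∘ ψ) y = (mvfderiv (𝓡 m) f (ψ y)).comp (mfderiv (𝓡 m) (𝓡 m) ψ y) := by
  rw [← mfderiv_eq_fderiv]
  exact mfderiv_comp y (hf.contMDiffAt.mdifferentiableAt (by simp))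
    (hψ.mdifferentiableAt (by simp))

variable [IsManifold (𝓡 m) ∞ M] {x : M}

theorem contMDiffAt_chartAt_symm (hy : y ∈ (chartAt ℝ^m x).target) :
    ContMDiffAt (𝓡 m) (𝓡 m) ∞ (chartAt ℝ^m x).symm y :=
  contMDiffOn_chart_symm.contMDiffAt ((chartAt ℝ^m x).open_target.mem_nhds hy)

theorem contMDiffAt_chartAt {z : M} (hz : z ∈ (chartAt ℝ^m x).source) :
    ContMDiffAt (𝓡 m) (𝓡 m) ∞ (chartAt ℝ^m x) z :=
  contMDiffOn_chart.contMDiffAt ((chartAt ℝ^m x).open_source.mem_nhds hz)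

theorem contDiffAt_fderiv_comp_chartAt_symm (hf : ContMDiff (𝓡 m) 𝓘(ℝ, ℝ) ∞ f)
    (hy : y ∈ (chartAt ℝ^m x).target) :
    ContDiffAt ℝ ∞ (fderiv ℝ (f ∘ (chartAt ℝ^m x).symm)) y :=
  (contDiffAt_comp_of_contMDiffAt hf (contMDiffAt_chartAt_symm hy)).fderiv_right (by simp)

theorem fderiv_fderiv_comp_eq_hessian (hf : ContMDiff (𝓡 m) 𝓘(ℝ, ℝ) ∞ f)
    (hψ : ContMDiffAt (𝓡 m) (𝓡 m) ∞ ψ y) (hcrit : mvfderiv (𝓡 m) f (ψ y) = 0) (X Y : ℝ^m) :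
    fderiv ℝ (fderiv ℝ (f ∘ ψ)) y X Y =
      hessian f (ψ y) (mfderiv (𝓡 m) (𝓡 m) ψ y X) (mfderiv (𝓡 m) (𝓡 m) ψ y Y) := by
  set c := chartAt ℝ^m (ψ y)
  have hsource : ψ y ∈ c.source := mem_chart_source _ _
  have hinv : c.symm (c (ψ y)) = ψ y := c.left_inv hsource
  have hsymm : ContMDiffAt (𝓡 m) (𝓡 m) ∞ c.symm (c (ψ y)) :=
    contMDiffAt_chartAt_symm (c.map_source hsource)
  have htransition : ContDiffAt ℝ ∞ (c ∘ ψ) y :=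
    ((contMDiffAt_chartAt hsource).comp y hψ).contDiffAt
  have hlocal : ContDiffAt ℝ ∞ (f ∘ c.symm) (c (ψ y)) := contDiffAt_comp_of_contMDiffAt hf hsymm
  have hlocal_crit : fderiv ℝ (f ∘ c.symm) (c (ψ y)) = 0 := by
    rw [fderiv_comp_eq_mvfderiv_comp hf hsymm, hinv, hcrit]
    exact ContinuousLinearMap.zero_comp _
  have hfactor : f ∘ ψ =ᶠ[nhds y] (f ∘ c.symm) ∘ (c ∘ ψ) := by
    filter_upwards [hψ.continuousAt (c.open_source.mem_nhds hsource)] with z hz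
    simp only [Function.comp_apply]
    rw [c.left_inv hz]
  have hfderiv : fderiv ℝ (c ∘ ψ) y =
      (mfderiv (𝓡 m) (𝓡 m) c (ψ y)).comp (mfderiv (𝓡 m) (𝓡 m) ψ y) := by
    rw [← mfderiv_eq_fderiv]
    exact mfderiv_comp y ((contMDiffAt_chartAt hsource).mdifferentiableAt (by simp))
      (hψ.mdifferentiableAt (by simp))
  have htwo : (2 : ℕ∞ω) ≤ (∞ : ℕ∞ω) := WithTop.coe_le_coe.2 le_top
  rw [hfactor.fderiv.fderiv_eq, fderiv_fderiv_comp_of_fderiv_eq_zero (φ := c ∘ ψ)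
    (hlocal.of_le htwo) (htransition.of_le htwo) hlocal_crit, hfderiv, hessian_apply]
  rfl

end Parametrization

variable {V : Submodule ℝ C^∞⟮𝓡 m, M; ℝ⟯} {h : InnerProductSpace.Core ℝ V}
  [FiniteDimensional ℝ V]

variable (V h) in
/-- The map that sends `v` to the gradient of `v` at `y` in the coordinates of the preferred chart
at `x`, with respect to the Euclidean metric of the coordinates. -/
def coordGradient (x : M) (y : ℝ^m) : SampleSpace V h →L[ℝ] ℝ^m :=
  (ofDual ℝ^m).comp ((ContinuousLinearMap.precomp ℝ
    (mfderiv (𝓡 m) (𝓡 m) (chartAt ℝ^m x).symm y : ℝ^m →L[ℝ] TangentSpace (𝓡 m) _)).comp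
      (LinearMap.toContinuousLinearMap (adjunction ((chartAt ℝ^m x).symm y))))

theorem inner_coordGradient (x : M) (y X : ℝ^m) (v : SampleSpace V h) :
    ⟪coordGradient V h x y v, X⟫_ℝ = adjunction ((chartAt ℝ^m x).symm y) v
      (mfderiv (𝓡 m) (𝓡 m) (chartAt ℝ^m x).symm y X) :=
  inner_ofDual _ _

variable [IsManifold (𝓡 m) ∞ M]

/-- The differential of the inverse of the preferred chart at `x`, as an isomorphism. -/
def coordFrame (x : M) {y : ℝ^m} (hy : y ∈ (chartAt ℝ^m x).target) :
    ℝ^m ≃L[ℝ] TangentSpace (𝓡 m) ((chartAt ℝ^m x).symm y) :=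
  (mdifferentiable_chart (I := 𝓡 m) x).symm.mfderiv hy

section Frame

variable {x : M} {y : ℝ^m} (hy : y ∈ (chartAt ℝ^m x).target)
include hy

theorem coe_coordFrame :
    (coordFrame x hy : ℝ^m →L[ℝ] _) = mfderiv (𝓡 m) (𝓡 m) (chartAt ℝ^m x).symm y := rfl

theorem coordGradient_apply (v : SampleSpace V h) :
    coordGradient V h x y v = ofDual ℝ^m (fderiv ℝ ((v : M → ℝ) ∘ (chartAt ℝ^m x).symm) y) := by
  rw [fderiv_comp_eq_mvfderiv_comp v.toSmooth.contMDiff (contMDiffAt_chartAt_symm hy)]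
  rfl

theorem coordGradient_eq_zero_iff (v : SampleSpace V h) :
    coordGradient V h x y v = 0 ↔ (chartAt ℝ^m x).symm y ∈ criticalSet v := by
  refine ⟨fun hzero => ?_, fun hzero => ext_inner_right ℝ fun X => ?_⟩
  · ext X
    obtain ⟨Y, rfl⟩ := (coordFrame x hy).surjective X
    exact (inner_coordGradient x y Y v).symm.trans (by rw [hzero, inner_zero_left]; rfl)
  · rw [inner_coordGradient, show adjunction _ v = 0 from hzero, inner_zero_left]
    rfl

theorem ker_coordGradient :
    LinearMap.ker (coordGradient V h x y : SampleSpace V h →ₗ[ℝ] ℝ^m) =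
      kernelSpace V h ((chartAt ℝ^m x).symm y) :=
  Submodule.ext (coordGradient_eq_zero_iff hy)

theorem adjoint_coordGradient :
    LinearMap.adjoint (coordGradient V h x y : SampleSpace V h →ₗ[ℝ] ℝ^m) =
      dualAdjunction ((chartAt ℝ^m x).symm y) ∘ₗ
        (coordFrame x hy).toLinearEquiv.toLinearMap := by
  ext X : 1
  refine ext_inner_right ℝ fun v => ?_
  rw [LinearMap.adjoint_inner_left, real_inner_comm]
  exact (inner_coordGradient x y X v).trans (inner_dualAdjunction _ _ v).symm

theorem coordGradient_surjective (hV : IsAmple V h) :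
    Function.Surjective (coordGradient V h x y) := by
  intro X
  obtain ⟨v, hv⟩ := hV ((chartAt ℝ^m x).symm y)
    ((innerSL ℝ X).comp ((coordFrame x hy).symm : _ →L[ℝ] ℝ^m))
  refine ⟨v, ext_inner_right ℝ fun Y => ?_⟩
  rw [inner_coordGradient, hv, ← coe_coordFrame hy]
  exact congrArg (fun Z => ⟪X, Z⟫_ℝ) ((coordFrame x hy).symm_apply_apply Y)

theorem coordGradient_apply_eventuallyEq (v : SampleSpace V h) :
    (fun z => coordGradient V h x z v) =ᶠ[nhds y]
      fun z => ofDual ℝ^m (fderiv ℝ ((v : M → ℝ) ∘ (chartAt ℝ^m x).symm) z) := by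
  filter_upwards [(chartAt ℝ^m x).open_target.mem_nhds hy] with z hz using coordGradient_apply hz v

end Frame

theorem contDiffOn_coordGradient (x : M) :
    ContDiffOn ℝ ∞ (coordGradient V h x) (chartAt ℝ^m x).target :=
  contDiffOn_clm_apply.2 fun v y hy =>
    (((ofDual ℝ^m).contDiff.contDiffAt.comp y
      (contDiffAt_fderiv_comp_chartAt_symm v.toSmooth.contMDiff hy)).congr_of_eventuallyEq
        (coordGradient_apply_eventuallyEq hy v)).contDiffWithinAt

theorem inner_fderiv_coordGradient {x : M} {y : ℝ^m} (hy : y ∈ (chartAt ℝ^m x).target)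
    (v : SampleSpace V h) (X Y : ℝ^m) :
    ⟪(fderiv ℝ (coordGradient V h x) y).flip v X, Y⟫_ℝ =
      fderiv ℝ (fderiv ℝ ((v : M → ℝ) ∘ (chartAt ℝ^m x).symm)) y X Y := by
  have hgradient : DifferentiableAt ℝ (coordGradient V h x) y :=
    ((contDiffOn_coordGradient x).contDiffAt
      ((chartAt ℝ^m x).open_target.mem_nhds hy)).differentiableAt (by simp)
  have hleft : HasFDerivAt (fun z => coordGradient V h x z v)
      ((fderiv ℝ (coordGradient V h x) y).flip v) y := by
    simpa using hgradient.hasFDerivAt.clm_apply (hasFDerivAt_const v y)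
  have hright : HasFDerivAt (fun z => coordGradient V h x z v)
      ((ofDual ℝ^m).comp
        (fderiv ℝ (fderiv ℝ ((v : M → ℝ) ∘ (chartAt ℝ^m x).symm)) y)) y :=
    ((ofDual ℝ^m).hasFDerivAt.comp y
      ((contDiffAt_fderiv_comp_chartAt_symm v.toSmooth.contMDiff hy).differentiableAt
        (by simp)).hasFDerivAt).congr_of_eventuallyEq (coordGradient_apply_eventuallyEq hy v)
  rw [hleft.unique hright]
  exact inner_ofDual _ _

end Manifold

/-! ### The densities in coordinates -/

theorem finrank_mul_zeroDensity {E F : Type*} [NormedAddCommGroup E] [InnerProductSpace ℝ E]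
    [FiniteDimensional ℝ E] [NormedAddCommGroup F] [InnerProductSpace ℝ F]
    [FiniteDimensional ℝ F] [MeasurableSpace F] [BorelSpace F] {A : E → F →L[ℝ] E} {y : E}
    {K : Submodule ℝ F} (hK : LinearMap.ker (A y : F →ₗ[ℝ] E) = K) :
    ((Module.finrank ℝ K + Module.finrank ℝ E : ℕ) : ℝ≥0∞) * zeroDensity A y =
      ENNReal.ofReal (LinearMap.adjoint (A y : F →ₗ[ℝ] E)).normDet⁻¹ *
        ∫⁻ v : sphere (0 : K) 1, ENNReal.ofReal |((fderiv ℝ A y).flip v).det|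
          ∂(sphereArea K) := by
  subst hK
  rw [zeroDensity, mul_left_comm]
  congr 1
  exact (lintegral_sphere_abs_det ((fderiv ℝ A y).flip.comp (Submodule.subtypeL _))).symm

section Density

variable {m : ℕ} {M : Type*} [TopologicalSpace M] [ChartedSpace ℝ^m M]
  {V : Submodule ℝ C^∞⟮𝓡 m, M; ℝ⟯} {h : InnerProductSpace.Core ℝ V} [FiniteDimensional ℝ V]

theorem finrank_kernelSpace_add (hV : IsAmple V h) (x : M) :
    Module.finrank ℝ (kernelSpace V h x) + m = Module.finrank ℝ (SampleSpace V h) := by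
  have hcotangent : Module.finrank ℝ (TangentSpace (𝓡 m) x →L[ℝ] ℝ) = m := by
    have e : (TangentSpace (𝓡 m) x →L[ℝ] ℝ) ≃ₗ[ℝ] Module.Dual ℝ ℝ^m :=
      (LinearMap.toContinuousLinearMap (𝕜 := ℝ) (E := ℝ^m) (F' := ℝ)).symm
    rw [e.finrank_eq, Subspace.dual_finrank_eq, finrank_euclideanSpace_fin]
  rw [← LinearMap.finrank_range_add_finrank_ker (adjunction (V := V) (h := h) x),
    LinearMap.range_eq_top.2 (hV x), finrank_top, hcotangent, add_comm]
  rfl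

theorem hessianAverage_nonneg [RiemannianBundle (fun x : M => TangentSpace (𝓡 m) x)] (x : M) :
    0 ≤ hessianAverage V h x :=
  integral_nonneg fun _ => abs_nonneg _

theorem criticalDensity_nonneg [RiemannianBundle (fun x : M => TangentSpace (𝓡 m) x)] (x : M) :
    0 ≤ criticalDensity V h x :=
  div_nonneg (hessianAverage_nonneg x) (jacobian_nonneg _)

variable [IsManifold (𝓡 m) ∞ M]

theorem continuousOn_coordVector (x : M) (i : Fin m) :
    ContinuousOn (fun y => (⟨(chartAt ℝ^m x).symm y, coordVector x y i⟩ :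
      TotalSpace ℝ^m (fun x : M => TangentSpace (𝓡 m) x))) (chartAt ℝ^m x).target := by
  have htangent : ContinuousOn (tangentMapWithin (𝓡 m) (𝓡 m) (chartAt ℝ^m x).symm
      (chartAt ℝ^m x).target) _ :=
    (contMDiffOn_chart_symm (I := 𝓡 m) (n := ∞) (x := x)).continuousOn_tangentMapWithin
      (by simp) (chartAt ℝ^m x).open_target.uniqueMDiffOn
  have hconst : Continuous fun y : ℝ^m =>
      (⟨y, EuclideanSpace.single i (1 : ℝ)⟩ : TangentBundle (𝓡 m) ℝ^m) := by
    have hmodel := (tangentBundleModelSpaceHomeomorph (𝓡 m)).symm.continuous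
    rw [tangentBundleModelSpaceHomeomorph_coe_symm] at hmodel
    exact hmodel.comp (Continuous.prodMk_left (EuclideanSpace.single i (1 : ℝ)))
  refine (htangent.comp hconst.continuousOn fun y hy => hy).congr fun y hy => ?_
  simp only [Function.comp_apply, tangentMapWithin, coordVector]
  rw [mfderivWithin_of_isOpen (chartAt ℝ^m x).open_target hy]

variable [RiemannianBundle (fun x : M => TangentSpace (𝓡 m) x)] {x : M} {y : ℝ^m}

section ChartTarget

variable (hy : y ∈ (chartAt ℝ^m x).target)
include hy

theorem volumeDensity_eq_normDet :
    volumeDensity x y = (coordFrame x hy).toLinearEquiv.toLinearMap.normDet := by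
  rw [← sqrt_det_gram_eq_normDet (EuclideanSpace.basisFun (Fin m) ℝ), volumeDensity]
  congr 2
  ext i j
  simp only [Matrix.gram, Matrix.of_apply, EuclideanSpace.basisFun_apply]
  rfl

theorem volumeDensity_pos : 0 < volumeDensity x y := by
  rw [volumeDensity_eq_normDet hy]
  exact normDet_linearEquiv_pos _

theorem normDet_adjoint_coordGradient :
    (LinearMap.adjoint (coordGradient V h x y : SampleSpace V h →ₗ[ℝ] ℝ^m)).normDet =
      jacobian (dualAdjunction (V := V) (h := h) ((chartAt ℝ^m x).symm y)) *
        volumeDensity x y := by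
  rw [volumeDensity_eq_normDet hy, jacobian_eq_normDet, adjoint_coordGradient hy]
  exact LinearMap.normDet_comp_of_finrank_eq _ _ (coordFrame x hy).toLinearEquiv.finrank_eq

theorem flip_fderiv_coordGradient {v : SampleSpace V h}
    (hv : v ∈ kernelSpace V h ((chartAt ℝ^m x).symm y)) :
    ((fderiv ℝ (coordGradient V h x) y).flip v).toLinearMap =
      LinearMap.adjoint (coordFrame x hy).toLinearEquiv.toLinearMap ∘ₗ
        (hessianOperator (m := m) v.toSmooth ((chartAt ℝ^m x).symm y)).toLinearMap ∘ₗ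
          (coordFrame x hy).toLinearEquiv.toLinearMap := by
  ext X : 1
  refine ext_inner_right ℝ fun Y => ?_
  rw [LinearMap.comp_apply, LinearMap.adjoint_inner_left]
  refine (inner_fderiv_coordGradient hy v X Y).trans ?_
  rw [fderiv_fderiv_comp_eq_hessian v.toSmooth.contMDiff (contMDiffAt_chartAt_symm hy)
    (LinearMap.mem_ker.1 hv)]
  exact (inner_operatorOfBilin _ _ _).symm

theorem abs_det_fderiv_coordGradient {v : SampleSpace V h}
    (hv : v ∈ kernelSpace V h ((chartAt ℝ^m x).symm y)) :
    |((fderiv ℝ (coordGradient V h x) y).flip v).det| = volumeDensity x y ^ 2 *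
      |(hessianOperator (m := m) v.toSmooth ((chartAt ℝ^m x).symm y)).det| := by
  rw [ContinuousLinearMap.det, flip_fderiv_coordGradient hy hv, det_adjoint_comp_comp,
    volumeDensity_eq_normDet hy, abs_mul, abs_of_nonneg (sq_nonneg _)]

theorem lintegral_sphere_abs_det_fderiv_coordGradient :
    ∫⁻ v : sphere (0 : kernelSpace V h ((chartAt ℝ^m x).symm y)) 1,
        ENNReal.ofReal |((fderiv ℝ (coordGradient V h x) y).flip (v : SampleSpace V h)).det|
          ∂(sphereArea _) =
      ENNReal.ofReal (volumeDensity x y ^ 2 * hessianAverage V h ((chartAt ℝ^m x).symm y)) := by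
  have hcontinuous : Continuous fun v : sphere
      (0 : kernelSpace V h ((chartAt ℝ^m x).symm y)) 1 =>
        |((fderiv ℝ (coordGradient V h x) y).flip (v : SampleSpace V h)).det| :=
    (ContinuousLinearMap.continuous_det.comp
      ((fderiv ℝ (coordGradient V h x) y).flip.continuous.comp
        (continuous_subtype_val.comp continuous_subtype_val))).abs
  have : ProperSpace (kernelSpace V h ((chartAt ℝ^m x).symm y)) := FiniteDimensional.proper ℝ _
  rw [← ofReal_integral_eq_lintegral_ofReal
    (integrableOn_univ.1 (hcontinuous.continuousOn.integrableOn_compact isCompact_univ))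
    (Filter.Eventually.of_forall fun v => abs_nonneg _), hessianAverage, ← integral_const_mul]
  congr 1
  exact integral_congr_ae
    (Filter.Eventually.of_forall fun v => abs_det_fderiv_coordGradient hy v.1.2)

theorem finrank_mul_zeroDensity_coordGradient (hV : IsAmple V h) :
    (Module.finrank ℝ (SampleSpace V h) : ℝ≥0∞) * zeroDensity (coordGradient V h x) y =
      ENNReal.ofReal (criticalDensity V h ((chartAt ℝ^m x).symm y)) *
        ENNReal.ofReal (volumeDensity x y) := by
  have hvolume := volumeDensity_pos hy
  have hpolar := finrank_mul_zeroDensity (ker_coordGradient (V := V) (h := h) hy)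
  rw [finrank_euclideanSpace_fin, finrank_kernelSpace_add hV,
    lintegral_sphere_abs_det_fderiv_coordGradient hy, normDet_adjoint_coordGradient hy] at hpolar
  rw [hpolar, ← ENNReal.ofReal_mul (inv_nonneg.2 (mul_nonneg (jacobian_nonneg _) hvolume.le)),
    ← ENNReal.ofReal_mul (criticalDensity_nonneg _), criticalDensity]
  congr 1
  field_simp

end ChartTarget

theorem continuousOn_volumeDensity [IsManifold (𝓡 m) 1 M]
    [IsContinuousRiemannianBundle ℝ^m (fun x : M => TangentSpace (𝓡 m) x)] (x : M) :
    ContinuousOn (volumeDensity x) (chartAt ℝ^m x).target := by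
  have hgram : ContinuousOn (fun y => Matrix.gram ℝ (coordVector x y)) (chartAt ℝ^m x).target :=
    continuousOn_pi.2 fun i => continuousOn_pi.2 fun j =>
      (continuousOn_coordVector x i).inner_bundle (continuousOn_coordVector x j)
  exact Real.continuous_sqrt.comp_continuousOn
    ((continuous_id.matrix_det).comp_continuousOn hgram)

end Density

/-! ### The Riemannian volume in a chart -/

theorem restrict_iSup_eq_of_forall_restrict_le {ι X : Type*} [MeasurableSpace X]
    {μ : ι → Measure X} {s : Set X} {i : ι} (hs : MeasurableSet s)
    (hle : ∀ j, (μ j).restrict s ≤ μ i) : (⨆ j, μ j).restrict s = (μ i).restrict s := by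
  have hsup : ⨆ j, μ j ≤ (μ i).restrict s + (⨆ j, μ j).restrict sᶜ := by
    refine iSup_le fun j => ?_
    rw [← Measure.restrict_add_restrict_compl (μ := μ j) hs]
    refine add_le_add ?_ (Measure.restrict_mono le_rfl (le_iSup μ j))
    simpa only [Measure.restrict_restrict hs, Set.inter_self] using
      Measure.restrict_mono (le_refl s) (hle j)
  refine le_antisymm ?_ (Measure.restrict_mono le_rfl (le_iSup μ i))
  have hrestrict := Measure.restrict_mono (le_refl s) hsup
  rwa [Measure.restrict_add, Measure.restrict_restrict hs, Measure.restrict_restrict hs,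
    Set.inter_self, Set.inter_compl_self, Measure.restrict_empty, add_zero] at hrestrict

section Volume

variable {m : ℕ} {M : Type*} [TopologicalSpace M] [ChartedSpace ℝ^m M]

/-- The set of the coordinates of the points of `P`, in the preferred chart at `x`. -/
def chartPart (x : M) (P : Set M) : Set ℝ^m :=
  (chartAt ℝ^m x).target ∩ (chartAt ℝ^m x).symm ⁻¹' P

theorem chartPart_inter_source (x : M) (P : Set M) :
    chartPart (m := m) x (P ∩ (chartAt ℝ^m x).source) = chartPart x P := by
  ext y
  exact ⟨fun hy => ⟨hy.1, hy.2.1⟩, fun hy => ⟨hy.1, hy.2, (chartAt ℝ^m x).map_target hy.1⟩⟩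

theorem image_transition_chartPart {x x' : M} {P : Set M} (hx : P ⊆ (chartAt ℝ^m x).source)
    (hx' : P ⊆ (chartAt ℝ^m x').source) :
    (chartAt ℝ^m x').symm.trans (chartAt ℝ^m x) '' chartPart x' P = chartPart x P := by
  rw [chartPart, chartPart, ← (chartAt ℝ^m x').image_eq_target_inter_inv_preimage hx',
    ← (chartAt ℝ^m x).image_eq_target_inter_inv_preimage hx, Set.image_image]
  exact Set.image_congr fun z hz => congrArg (chartAt ℝ^m x) ((chartAt ℝ^m x').left_inv (hx' hz))

section Transition

variable [IsManifold (𝓡 m) ∞ M] {x x' : M} {y : ℝ^m}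
  (hy : y ∈ ((chartAt ℝ^m x).symm.trans (chartAt ℝ^m x')).source)
include hy

theorem contMDiffAt_transition :
    ContMDiffAt (𝓡 m) (𝓡 m) ∞ ((chartAt ℝ^m x).symm.trans (chartAt ℝ^m x')) y :=
  (contMDiffAt_chartAt hy.2).comp y (contMDiffAt_chartAt_symm hy.1)

theorem mfderiv_chartAt_symm_apply_eq_transition (X : ℝ^m) :
    (mfderiv (𝓡 m) (𝓡 m) (chartAt ℝ^m x).symm y X : ℝ^m) =
      mfderiv (𝓡 m) (𝓡 m) (chartAt ℝ^m x').symm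
        ((chartAt ℝ^m x).symm.trans (chartAt ℝ^m x') y)
          (fderiv ℝ ((chartAt ℝ^m x).symm.trans (chartAt ℝ^m x')) y X) := by
  set τ := (chartAt ℝ^m x).symm.trans (chartAt ℝ^m x')
  have hfactor : (chartAt ℝ^m x).symm =ᶠ[nhds y] (chartAt ℝ^m x').symm ∘ τ := by
    filter_upwards [τ.open_source.mem_nhds hy] with z hz
    exact ((chartAt ℝ^m x').left_inv hz.2).symm
  have hchain : mfderiv (𝓡 m) (𝓡 m) ((chartAt ℝ^m x').symm ∘ τ) y =
      (mfderiv (𝓡 m) (𝓡 m) (chartAt ℝ^m x').symm (τ y)).comp (mfderiv (𝓡 m) (𝓡 m) τ y) :=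
    mfderiv_comp y
      ((contMDiffAt_chartAt_symm ((chartAt ℝ^m x').map_source hy.2)).mdifferentiableAt (by simp))
      ((contMDiffAt_transition hy).mdifferentiableAt (by simp))
  rw [← mfderiv_eq_fderiv]
  exact DFunLike.congr_fun (hfactor.mfderiv_eq.trans hchain) X

variable [RiemannianBundle (fun x : M => TangentSpace (𝓡 m) x)]

theorem volumeDensity_eq_abs_det_transition_mul :
    volumeDensity x y = |(fderiv ℝ ((chartAt ℝ^m x).symm.trans (chartAt ℝ^m x')) y).det| *
      volumeDensity x' ((chartAt ℝ^m x).symm.trans (chartAt ℝ^m x') y) := by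
  set τ := (chartAt ℝ^m x).symm.trans (chartAt ℝ^m x')
  have htarget : τ y ∈ (chartAt ℝ^m x').target := (chartAt ℝ^m x').map_source hy.2
  have hsame : (chartAt ℝ^m x).symm y = (chartAt ℝ^m x').symm (τ y) :=
    ((chartAt ℝ^m x').left_inv hy.2).symm
  have hinner : ∀ {p q : M}, p = q → ∀ X Y : ℝ^m,
      @inner ℝ (TangentSpace (𝓡 m) p) _ X Y = @inner ℝ (TangentSpace (𝓡 m) q) _ X Y := by
    rintro p _ rfl X Y
    rfl
  have hvector (i : Fin m) : (coordVector x y i : ℝ^m) = (coordFrame x' htarget).toLinearEquiv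
      (fderiv ℝ τ y (EuclideanSpace.single i 1)) :=
    mfderiv_chartAt_symm_apply_eq_transition hy _
  rw [volumeDensity_eq_normDet htarget, ContinuousLinearMap.det, ← LinearMap.normDet_eq_abs_det,
    mul_comm, ← LinearMap.normDet_comp_of_finrank_eq _ _ rfl,
    ← sqrt_det_gram_eq_normDet (EuclideanSpace.basisFun (Fin m) ℝ), volumeDensity]
  congr 2
  ext i j
  simp only [Matrix.gram, Matrix.of_apply, EuclideanSpace.basisFun_apply]
  exact (hinner hsame _ _).trans (congrArg₂ (fun X Y : ℝ^m =>
    @inner ℝ (TangentSpace (𝓡 m) ((chartAt ℝ^m x').symm (τ y))) _ X Y) (hvector i) (hvector j))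

end Transition

variable [MeasurableSpace M] [BorelSpace M]

theorem aemeasurable_chartAt_symm (x : M) :
    AEMeasurable (chartAt ℝ^m x).symm (volume.restrict (chartAt ℝ^m x).target) :=
  (chartAt ℝ^m x).continuousOn_symm.aemeasurable (chartAt ℝ^m x).open_target.measurableSet

theorem measurableSet_chartPart (x : M) {P : Set M} (hP : MeasurableSet P) :
    MeasurableSet (chartPart (m := m) x P) := by
  classical
  have htarget := (chartAt ℝ^m x).open_target.measurableSet
  have hsymm : Measurable ((chartAt ℝ^m x).target.piecewise (chartAt ℝ^m x).symm fun _ => x) :=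
    (chartAt ℝ^m x).continuousOn_symm.measurable_piecewise continuousOn_const htarget
  rw [chartPart, ← (Set.piecewise_eqOn _ _ _).inter_preimage_eq]
  exact htarget.inter (hsymm hP)

variable [RiemannianBundle (fun x : M => TangentSpace (𝓡 m) x)]

theorem chartVolume_apply (x : M) {P : Set M} (hP : MeasurableSet P) :
    chartVolume (m := m) x P =
      ∫⁻ y in chartPart (m := m) x P, ENNReal.ofReal (volumeDensity x y) := by
  rw [chartVolume, Measure.map_apply_of_aemeasurable _ hP, withDensity_apply',
    Measure.restrict_restrict' (chartAt ℝ^m x).open_target.measurableSet, chartPart, Set.inter_comm]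
  exact (aemeasurable_chartAt_symm x).mono_ac (withDensity_absolutelyContinuous _ _)

theorem chartVolume_restrict (x : M) {P : Set M} (hP : MeasurableSet P) :
    (chartVolume (m := m) x).restrict P =
      ((volume.restrict (chartPart x P)).withDensity
        fun y => ENNReal.ofReal (volumeDensity x y)).map (chartAt ℝ^m x).symm := by
  have hsymm : AEMeasurable (chartAt ℝ^m x).symm
      ((volume.restrict (chartPart x P)).withDensity
        fun y => ENNReal.ofReal (volumeDensity x y)) :=
    ((aemeasurable_chartAt_symm x).mono_measure
      (Measure.restrict_mono Set.inter_subset_left le_rfl)).mono_ac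
        (withDensity_absolutelyContinuous _ _)
  ext B hB
  rw [Measure.restrict_apply hB, chartVolume_apply x (hB.inter hP),
    Measure.map_apply_of_aemeasurable hsymm hB, withDensity_apply',
    Measure.restrict_restrict' (measurableSet_chartPart x hP), chartPart, Set.preimage_inter,
    Set.inter_left_comm]
  rfl

variable [IsManifold (𝓡 m) ∞ M]

theorem chartVolume_eq_of_subset_source (x x' : M) {P : Set M} (hP : MeasurableSet P)
    (hx : P ⊆ (chartAt ℝ^m x).source) (hx' : P ⊆ (chartAt ℝ^m x').source) :
    chartVolume (m := m) x P = chartVolume (m := m) x' P := by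
  set τ := (chartAt ℝ^m x).symm.trans (chartAt ℝ^m x')
  have hsource : chartPart x P ⊆ τ.source := fun y hy => ⟨hy.1, hx' hy.2⟩
  have hderiv : ∀ y ∈ chartPart x P, HasFDerivWithinAt τ (fderiv ℝ τ y) (chartPart x P) y :=
    fun y hy => ((contMDiffAt_transition (hsource hy)).contDiffAt.differentiableAt
      (by simp)).hasFDerivAt.hasFDerivWithinAt
  rw [chartVolume_apply x hP, chartVolume_apply x' hP, ← image_transition_chartPart hx' hx,
    lintegral_image_eq_lintegral_abs_det_fderiv_mul volume (measurableSet_chartPart x hP) hderiv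
      (τ.injOn.mono hsource)]
  refine setLIntegral_congr_fun (measurableSet_chartPart x hP) fun y hy => ?_
  rw [← ENNReal.ofReal_mul (abs_nonneg _), volumeDensity_eq_abs_det_transition_mul (hsource hy)]

theorem riemannianVolume_restrict_source (x : M) :
    (riemannianVolume m M).restrict (chartAt ℝ^m x).source =
      (chartVolume (m := m) x).restrict (chartAt ℝ^m x).source := by
  have hsource (z : M) := (chartAt ℝ^m z).open_source.measurableSet
  refine restrict_iSup_eq_of_forall_restrict_le (hsource x) fun z => Measure.le_iff.2 fun B hB => ?_
  have hBx := hB.inter (hsource x)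
  rw [Measure.restrict_apply hB, chartVolume_apply z hBx, ← chartPart_inter_source,
    ← chartVolume_apply z (hBx.inter (hsource z)), chartVolume_eq_of_subset_source z x
      (hBx.inter (hsource z)) Set.inter_subset_right
        (Set.inter_subset_left.trans Set.inter_subset_right)]
  exact measure_mono (Set.inter_subset_left.trans Set.inter_subset_left)

end Volume

/-! ### Localization of the expected number of points -/

namespace HasIntensityOn

variable {Θ X : Type*} [MeasurableSpace Θ] [MeasurableSpace X] {P : Measure Θ} {μ : Measure X}
  {Z Z' : Θ → Set X} {ρ ρ' : X → ℝ≥0∞} {W W' : Set X}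

protected theorem empty : HasIntensityOn P μ Z ρ ∅ where
  aemeasurable_encard := by simp
  lintegral_encard := by simp
  aemeasurable_density := by simp
  lintegral_density_lt_top := by simp

theorem congr (hW : MeasurableSet W) (hZ : ∀ θ, W ∩ Z θ = W ∩ Z' θ) (hρ : Set.EqOn ρ ρ' W)
    (hi : HasIntensityOn P μ Z ρ W) : HasIntensityOn P μ Z' ρ' W where
  aemeasurable_encard := by simpa only [hZ] using hi.aemeasurable_encard
  lintegral_encard := by
    simpa only [hZ, setLIntegral_congr_fun hW hρ] using hi.lintegral_encard
  aemeasurable_density := hi.aemeasurable_density.congr ((ae_restrict_mem hW).mono hρ)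
  lintegral_density_lt_top := by
    simpa only [setLIntegral_congr_fun hW hρ] using hi.lintegral_density_lt_top

theorem union (hW' : MeasurableSet W') (hd : Disjoint W W') (hi : HasIntensityOn P μ Z ρ W)
    (hi' : HasIntensityOn P μ Z ρ W') : HasIntensityOn P μ Z ρ (W ∪ W') := by
  have hcount (θ : Θ) : (((W ∪ W') ∩ Z θ).encard : ℝ≥0∞) =
      (W ∩ Z θ).encard + (W' ∩ Z θ).encard := by
    rw [Set.union_inter_distrib_right,
      Set.encard_union_eq (hd.mono Set.inter_subset_left Set.inter_subset_left), ENat.toENNReal_add]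
  have hintegral := lintegral_union (μ := μ) (f := ρ) hW' hd
  refine ⟨?_, ?_, aemeasurable_union_iff.2 ⟨hi.aemeasurable_density, hi'.aemeasurable_density⟩, ?_⟩
  · simp only [hcount]
    exact hi.aemeasurable_encard.add hi'.aemeasurable_encard
  · simp_rw [hcount]
    rw [lintegral_add_left' hi.aemeasurable_encard, hi.lintegral_encard, hi'.lintegral_encard,
      hintegral]
  · rw [hintegral]
    exact ENNReal.add_lt_top.2 ⟨hi.lintegral_density_lt_top, hi'.lintegral_density_lt_top⟩

theorem univ_of_forall_exists_nhds [TopologicalSpace X] [CompactSpace X] [OpensMeasurableSpace X]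
    (hloc : ∀ x, ∃ O ∈ nhds x, ∀ W ⊆ O, MeasurableSet W → HasIntensityOn P μ Z ρ W) :
    HasIntensityOn P μ Z ρ Set.univ := by
  suffices hcover : ∃ T, Set.univ ⊆ T ∧ MeasurableSet T ∧
      ∀ W ⊆ T, MeasurableSet W → HasIntensityOn P μ Z ρ W by
    obtain ⟨T, hT, -, hi⟩ := hcover
    exact hi _ hT .univ
  refine isCompact_univ.induction_on (p := fun S => ∃ T, S ⊆ T ∧ MeasurableSet T ∧
    ∀ W ⊆ T, MeasurableSet W → HasIntensityOn P μ Z ρ W) ?_ ?_ ?_ ?_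
  · refine ⟨∅, subset_rfl, .empty, fun W hW _ => ?_⟩
    rw [Set.subset_empty_iff.1 hW]
    exact .empty
  · rintro S S' hS ⟨T, hT, hi⟩
    exact ⟨T, hS.trans hT, hi⟩
  · rintro S S' ⟨T, hST, hT, hi⟩ ⟨T', hST', hT', hi'⟩
    refine ⟨T ∪ T', Set.union_subset_union hST hST', hT.union hT', fun W hWT hW => ?_⟩
    rw [← Set.inter_union_sdiff W T]
    exact (hi _ Set.inter_subset_right (hW.inter hT)).union (hW.diff hT)
      Set.disjoint_sdiff_inter.symm (hi' _ (Set.sdiff_subset_iff.2 hWT) (hW.diff hT))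
  · rintro x -
    obtain ⟨O, hO, hi⟩ := hloc x
    exact ⟨interior O, nhdsWithin_le_nhds (interior_mem_nhds.2 hO), interior O, subset_rfl,
      isOpen_interior.measurableSet, fun W hW => hi W (hW.trans interior_subset)⟩

theorem sphere {F : Type*} [NormedAddCommGroup F] [InnerProductSpace ℝ F] [FiniteDimensional ℝ F]
    [MeasurableSpace F] [BorelSpace F] {Z : F → Set X}
    (hZ : ∀ r : ℝ, 0 < r → ∀ v, Z (r • v) = Z v)
    (hi : HasIntensityOn (volume.restrict (ball (0 : F) 1)) μ Z ρ W) :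
    HasIntensityOn (sphereArea F) μ (fun v : Metric.sphere (0 : F) 1 => Z v)
      (fun x => (Module.finrank ℝ F : ℝ≥0∞) * ρ x) W := by
  have hdensity := lintegral_const_mul'' (Module.finrank ℝ F : ℝ≥0∞) hi.aemeasurable_density
  have hhom (r : ℝ) (hr : 0 < r) (v : F) : ((W ∩ Z (r • v)).encard : ℝ≥0∞) =
      ENNReal.ofReal (r ^ 0) * (W ∩ Z v).encard := by simp [hZ r hr]
  have hcount : AEMeasurable (fun v : Metric.sphere (0 : F) 1 => ((W ∩ Z v).encard : ℝ≥0∞))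
      (sphereArea F) ∧ ∫⁻ v : Metric.sphere (0 : F) 1, (W ∩ Z v).encard ∂(sphereArea F) =
        (Module.finrank ℝ F : ℝ≥0∞) * ∫⁻ v in ball (0 : F) 1, (W ∩ Z v).encard := by
    rcases subsingleton_or_nontrivial F with hF | hF
    · exact ⟨Subsingleton.measurable.aemeasurable, by simp [Module.finrank_zero_of_subsingleton]⟩
    · exact ⟨aemeasurable_sphere_of_homogeneous hhom hi.aemeasurable_encard,
        lintegral_sphere_of_homogeneous hhom hi.aemeasurable_encard⟩
  refine ⟨hcount.1, ?_, hi.aemeasurable_density.const_mul _, ?_⟩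
  · rw [hcount.2, hi.lintegral_encard, hdensity]
  · rw [hdensity]
    exact ENNReal.mul_lt_top (ENNReal.natCast_lt_top _) hi.lintegral_density_lt_top

end HasIntensityOn

/-! ### The expected number of critical points -/

section Expectation

variable {m : ℕ} {M : Type*} [TopologicalSpace M] [ChartedSpace ℝ^m M]

theorem encard_chartPart {x : M} {W : Set M} (hW : W ⊆ (chartAt ℝ^m x).source) :
    (chartPart (m := m) x W).encard = W.encard := by
  rw [chartPart, ← (chartAt ℝ^m x).image_eq_target_inter_inv_preimage hW,
    ((chartAt ℝ^m x).injOn.mono hW).encard_image]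

section Chart

variable [IsManifold (𝓡 m) ∞ M] [MeasurableSpace M] [BorelSpace M]
  [RiemannianBundle (fun x : M => TangentSpace (𝓡 m) x)] {x : M} {W : Set M} {ρ : M → ℝ≥0∞}

theorem riemannianVolume_restrict_of_subset_source (hWm : MeasurableSet W)
    (hW : W ⊆ (chartAt ℝ^m x).source) :
    (riemannianVolume m M).restrict W =
      ((volume.restrict (chartPart x W)).withDensity
        fun y => ENNReal.ofReal (volumeDensity x y)).map (chartAt ℝ^m x).symm := by
  rw [← chartVolume_restrict x hWm, ← Set.inter_eq_left.2 hW, ← Measure.restrict_restrict hWm,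
    ← Measure.restrict_restrict hWm, riemannianVolume_restrict_source]

theorem aemeasurable_of_aemeasurable_comp_chartAt_symm (hWm : MeasurableSet W)
    (hW : W ⊆ (chartAt ℝ^m x).source)
    (hρ : AEMeasurable (fun y => ρ ((chartAt ℝ^m x).symm y)) (volume.restrict (chartPart x W))) :
    AEMeasurable ρ ((riemannianVolume m M).restrict W) := by
  set ν := (volume.restrict (chartPart (m := m) x W)).withDensity
    fun y => ENNReal.ofReal (volumeDensity x y)
  have hν : ν ≪ volume.restrict (chartPart x W) := withDensity_absolutelyContinuous _ _
  have hchart : AEMeasurable (chartAt ℝ^m x) ((riemannianVolume m M).restrict W) :=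
    ((chartAt ℝ^m x).continuousOn.mono hW).aemeasurable hWm
  have hsymm : AEMeasurable (chartAt ℝ^m x).symm ν :=
    ((aemeasurable_chartAt_symm x).mono_measure
      (Measure.restrict_mono Set.inter_subset_left le_rfl)).mono_ac hν
  have hmap : ((riemannianVolume m M).restrict W).map (chartAt ℝ^m x) = ν := by
    rw [riemannianVolume_restrict_of_subset_source hWm hW] at hchart ⊢
    rw [AEMeasurable.map_map_of_aemeasurable hchart hsymm]
    refine (Measure.map_congr ?_).trans Measure.map_id
    filter_upwards [hν.ae_le (ae_restrict_mem (measurableSet_chartPart x hWm))] with y hy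
      using (chartAt ℝ^m x).right_inv hy.1
  have hcomp := (hmap.symm ▸ hρ.mono_ac hν).comp_aemeasurable hchart
  refine hcomp.congr ?_
  filter_upwards [ae_restrict_mem hWm] with z hz
  rw [Function.comp_apply, (chartAt ℝ^m x).left_inv (hW hz)]

variable [IsContinuousRiemannianBundle ℝ^m (fun x : M => TangentSpace (𝓡 m) x)]

theorem aemeasurable_volumeDensity (hWm : MeasurableSet W) :
    AEMeasurable (fun y => ENNReal.ofReal (volumeDensity x y))
      (volume.restrict (chartPart (m := m) x W)) :=
  haveI : IsManifold (𝓡 m) 1 M := IsManifold.of_le (n := ∞) (by simp)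
  (((continuousOn_volumeDensity x).mono Set.inter_subset_left).aemeasurable
    (measurableSet_chartPart x hWm)).ennreal_ofReal

theorem aemeasurable_comp_chartAt_symm (hWm : MeasurableSet W)
    (hρ : AEMeasurable (fun y => ρ ((chartAt ℝ^m x).symm y) * ENNReal.ofReal (volumeDensity x y))
      (volume.restrict (chartPart x W))) :
    AEMeasurable (fun y => ρ ((chartAt ℝ^m x).symm y)) (volume.restrict (chartPart x W)) := by
  refine (hρ.div (aemeasurable_volumeDensity hWm)).congr ?_
  filter_upwards [ae_restrict_mem (measurableSet_chartPart x hWm)] with y hy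
  exact ENNReal.mul_div_cancel_right (ENNReal.ofReal_pos.2 (volumeDensity_pos hy.1)).ne'
    ENNReal.ofReal_ne_top

theorem setLIntegral_riemannianVolume (hWm : MeasurableSet W) (hW : W ⊆ (chartAt ℝ^m x).source)
    (hρ : AEMeasurable (fun y => ρ ((chartAt ℝ^m x).symm y)) (volume.restrict (chartPart x W))) :
    ∫⁻ z in W, ρ z ∂(riemannianVolume m M) = ∫⁻ y in chartPart x W,
      ρ ((chartAt ℝ^m x).symm y) * ENNReal.ofReal (volumeDensity x y) := by
  have hmeas := aemeasurable_of_aemeasurable_comp_chartAt_symm hWm hW hρ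
  rw [riemannianVolume_restrict_of_subset_source hWm hW] at hmeas ⊢
  rw [lintegral_map' hmeas, lintegral_withDensity_eq_lintegral_mul₀
    (aemeasurable_volumeDensity hWm) hρ]
  · simp only [Pi.mul_apply, mul_comm]
  · exact ((aemeasurable_chartAt_symm x).mono_measure
      (Measure.restrict_mono Set.inter_subset_left le_rfl)).mono_ac
        (withDensity_absolutelyContinuous _ _)

theorem HasIntensityOn.of_chartPart {Θ : Type*} [MeasurableSpace Θ] {P : Measure Θ}
    {Z : Θ → Set M} (hWm : MeasurableSet W) (hW : W ⊆ (chartAt ℝ^m x).source)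
    (hi : HasIntensityOn P volume (fun θ => (chartAt ℝ^m x).symm ⁻¹' Z θ)
      (fun y => ρ ((chartAt ℝ^m x).symm y) * ENNReal.ofReal (volumeDensity x y))
      (chartPart x W)) :
    HasIntensityOn P (riemannianVolume m M) Z ρ W := by
  have hcount (θ : Θ) : (W ∩ Z θ).encard =
      (chartPart x W ∩ (chartAt ℝ^m x).symm ⁻¹' Z θ).encard := by
    rw [← encard_chartPart (Set.inter_subset_left.trans hW), chartPart, chartPart,
      Set.preimage_inter, Set.inter_assoc]
  have hρ := aemeasurable_comp_chartAt_symm hWm hi.aemeasurable_density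
  have hintegral := setLIntegral_riemannianVolume hWm hW hρ
  refine ⟨?_, ?_, aemeasurable_of_aemeasurable_comp_chartAt_symm hWm hW hρ, ?_⟩
  · simpa only [hcount] using hi.aemeasurable_encard
  · simpa only [hcount, hintegral] using hi.lintegral_encard
  · simpa only [hintegral] using hi.lintegral_density_lt_top

end Chart

variable {V : Submodule ℝ C^∞⟮𝓡 m, M; ℝ⟯} {h : InnerProductSpace.Core ℝ V} [FiniteDimensional ℝ V]
  [IsManifold (𝓡 m) ∞ M] [MeasurableSpace M] [BorelSpace M]
  [RiemannianBundle (fun x : M => TangentSpace (𝓡 m) x)]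
  [IsContinuousRiemannianBundle ℝ^m (fun x : M => TangentSpace (𝓡 m) x)]

theorem exists_nhds_hasIntensityOn_criticalSet (hV : IsAmple V h) (x : M) :
    ∃ O ∈ nhds x, ∀ W ⊆ O, MeasurableSet W →
      HasIntensityOn (sphereArea (SampleSpace V h)) (riemannianVolume m M)
        (fun v => criticalSet (v : SampleSpace V h))
        (fun z => ENNReal.ofReal (criticalDensity V h z)) W := by
  set c := chartAt ℝ^m x
  have hx : x ∈ c.source := mem_chart_source _ x
  obtain ⟨r, hr, -, hball⟩ := exists_ball_hasIntensityOn_zeros (A := coordGradient V h x)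
    c.open_target ((contDiffOn_coordGradient x).of_le (by simp)) (c.map_source hx)
    (coordGradient_surjective (c.map_source hx) hV)
  refine ⟨c.source ∩ c ⁻¹' ball (c x) r, (c.isOpen_inter_preimage isOpen_ball).mem_nhds
    ⟨hx, mem_ball_self hr⟩, fun W hW hWm => ?_⟩
  have hWball : chartPart x W ⊆ ball (c x) r := by
    rintro y ⟨hy, hyW⟩
    have hyball : c (c.symm y) ∈ ball (c x) r := (hW hyW).2
    rwa [c.right_inv hy] at hyball
  have hWc : MeasurableSet (chartPart (m := m) x W) := measurableSet_chartPart x hWm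
  have hscale (s : ℝ) (hs : 0 < s) (v : SampleSpace V h) :
      {y | coordGradient V h x y (s • v) = 0} = {y | coordGradient V h x y v = 0} := by
    simp only [map_smul, smul_eq_zero, hs.ne', false_or]
  refine .of_chartPart (x := x) hWm (fun z hz => (hW hz).1)
    (((hball _ hWball hWc).sphere hscale).congr hWc (fun v => ?_) fun y hy => ?_)
  · ext y
    exact and_congr_right fun hy => coordGradient_eq_zero_iff hy.1 _
  · exact finrank_mul_zeroDensity_coordGradient hy.1 hV

variable [CompactSpace M]

theorem hasIntensityOn_criticalSet (hV : IsAmple V h) :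
    HasIntensityOn (sphereArea (SampleSpace V h)) (riemannianVolume m M)
      (fun v => criticalSet (v : SampleSpace V h))
      (fun z => ENNReal.ofReal (criticalDensity V h z)) Set.univ :=
  .univ_of_forall_exists_nhds (exists_nhds_hasIntensityOn_criticalSet hV)

theorem aemeasurable_criticalCount (hV : IsAmple V h) :
    AEMeasurable (fun v : sphere (0 : SampleSpace V h) 1 => criticalCount (v : SampleSpace V h))
      (sphereArea (SampleSpace V h)) := by
  simpa only [criticalCount, Set.univ_inter] using
    (hasIntensityOn_criticalSet hV).aemeasurable_encard

theorem integrable_criticalDensity (hV : IsAmple V h) :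
    Integrable (criticalDensity V h) (riemannianVolume m M) := by
  have hi := hasIntensityOn_criticalSet hV
  have hmeas : AEMeasurable (criticalDensity V h) (riemannianVolume m M) := by
    simpa only [Measure.restrict_univ, ENNReal.toReal_ofReal (criticalDensity_nonneg _)] using
      hi.aemeasurable_density.ennreal_toReal
  refine ⟨hmeas.aestronglyMeasurable, ?_⟩
  rw [hasFiniteIntegral_iff_ofReal (Filter.Eventually.of_forall criticalDensity_nonneg)]
  simpa only [Measure.restrict_univ] using hi.lintegral_density_lt_top

theorem lintegral_sphere_criticalCount (hV : IsAmple V h) :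
    ∫⁻ v : sphere (0 : SampleSpace V h) 1, criticalCount (v : SampleSpace V h) ∂(sphereArea _) =
      ENNReal.ofReal (∫ x, criticalDensity V h x ∂(riemannianVolume m M)) := by
  rw [ofReal_integral_eq_lintegral_ofReal (integrable_criticalDensity hV)
    (Filter.Eventually.of_forall criticalDensity_nonneg)]
  simpa only [criticalCount, Set.univ_inter, Measure.restrict_univ] using
    (hasIntensityOn_criticalSet hV).lintegral_encard

theorem expectation_eq (hV : IsAmple V h) :
    expectation V h = ENNReal.ofReal (1 / sigma (Module.finrank ℝ V - 1) *
      ∫ x, criticalDensity V h x ∂(riemannianVolume m M)) := by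
  have hsigma := sigma_pos (Module.finrank ℝ V - 1)
  rw [expectation, ENNReal.ofReal_mul (one_div_pos.2 hsigma).le, one_div,
    ENNReal.ofReal_inv_of_pos hsigma, ← lintegral_sphere_criticalCount hV]
  rcases subsingleton_or_nontrivial (SampleSpace V h) with hS | hS
  · simp only [lintegral_of_isEmpty, ENNReal.zero_div, mul_zero]
  · rw [sphereArea_univ, ENNReal.div_eq_inv_mul]
    rfl

end Expectation

/-! ### Isometry invariance -/

section SphereIsometry

variable {E F : Type*} [NormedAddCommGroup E] [InnerProductSpace ℝ E]
  [MeasurableSpace E] [BorelSpace E] [NormedAddCommGroup F] [InnerProductSpace ℝ F]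
  [MeasurableSpace F] [BorelSpace F]

/-- A linear isometry `e`, restricted to the unit spheres. -/
def sphereEquiv (e : E ≃ₗᵢ[ℝ] F) : sphere (0 : E) 1 ≃ᵐ sphere (0 : F) 1 :=
  (e.toHomeomorph.subtype fun x => by simp).toMeasurableEquiv

open scoped Pointwise in
theorem smul_image_sphereEquiv_preimage (e : E ≃ₗᵢ[ℝ] F) (T : Set ℝ) (s : Set (sphere (0 : F) 1)) :
    T • ((↑) '' (sphereEquiv e ⁻¹' s) : Set E) = e ⁻¹' (T • ((↑) '' s : Set F)) := by
  have himage : ((↑) '' s : Set F) = e '' ((↑) '' (sphereEquiv e ⁻¹' s)) := by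
    rw [← (sphereEquiv e).surjective.image_preimage s, Set.image_image, Set.image_image,
      (sphereEquiv e).preimage_image]
    rfl
  have hsmul (S : Set E) : T • e '' S = e '' (T • S) :=
    (Set.image_image2_distrib_right fun r v => map_smul e r v).symm
  rw [himage, hsmul, Set.preimage_image_eq _ e.injective]

variable [FiniteDimensional ℝ E] [FiniteDimensional ℝ F]

theorem measurePreserving_sphereEquiv (e : E ≃ₗᵢ[ℝ] F) :
    MeasurePreserving (sphereEquiv e) (sphereArea E) (sphereArea F) := by
  refine ⟨(sphereEquiv e).measurable, Measure.ext fun s hs => ?_⟩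
  rw [(sphereEquiv e).map_apply, sphereArea, sphereArea, Measure.toSphere_apply' _ hs,
    Measure.toSphere_apply' _ ((sphereEquiv e).measurable hs), smul_image_sphereEquiv_preimage,
    e.toLinearEquiv.finrank_eq,
    e.measurePreserving.measure_preimage_emb e.toMeasurableEquiv.measurableEmbedding]

end SphereIsometry

section Pullback

variable {m : ℕ} {M : Type*} [TopologicalSpace M] [ChartedSpace ℝ^m M]
  {V : Submodule ℝ C^∞⟮𝓡 m, M; ℝ⟯} {h : InnerProductSpace.Core ℝ V}

theorem adjunction_comp {f : M → M} {x : M} (hf : MDifferentiableAt (𝓡 m) (𝓡 m) f x)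
    {u v : SampleSpace V h} (huv : ∀ z, u z = v (f z)) (X : TangentSpace (𝓡 m) x) :
    adjunction x u X = adjunction (f x) v (mfderiv (𝓡 m) (𝓡 m) f x X) := by
  have hcomp : (u : M → ℝ) = (v : M → ℝ) ∘ f := funext huv
  have hchain : mfderiv (𝓡 m) 𝓘(ℝ, ℝ) ((v : M → ℝ) ∘ f) x =
      (mfderiv (𝓡 m) 𝓘(ℝ, ℝ) v (f x)).comp (mfderiv (𝓡 m) (𝓡 m) f x) :=
    mfderiv_comp x (v.mdifferentiableAt _) hf
  change mfderiv (𝓡 m) 𝓘(ℝ, ℝ) (u : M → ℝ) x X = _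
  rw [hcomp, hchain]
  rfl

theorem hessian_comp [IsManifold (𝓡 m) ∞ M] {f : M → M} {x : M}
    (hf : ContMDiffAt (𝓡 m) (𝓡 m) ∞ f x) {u v : SampleSpace V h} (huv : ∀ z, u z = v (f z))
    (hcrit : v ∈ kernelSpace V h (f x)) (X Y : TangentSpace (𝓡 m) x) :
    hessian (m := m) u x X Y = hessian (m := m) v (f x) (mfderiv (𝓡 m) (𝓡 m) f x X)
      (mfderiv (𝓡 m) (𝓡 m) f x Y) := by
  suffices hchart : ∀ x₀ : M, ∀ y ∈ (chartAt ℝ^m x₀).target, (chartAt ℝ^m x₀).symm y = x →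
      hessian (m := m) u x X Y = hessian (m := m) v (f x) (mfderiv (𝓡 m) (𝓡 m) f x X)
        (mfderiv (𝓡 m) (𝓡 m) f x Y) from
    hchart x _ (mem_chart_target _ x) ((chartAt ℝ^m x).left_inv (mem_chart_source _ x))
  rintro x₀ y hy rfl
  obtain ⟨ξ, rfl⟩ := (coordFrame x₀ hy).surjective X
  obtain ⟨η, rfl⟩ := (coordFrame x₀ hy).surjective Y
  set c := chartAt ℝ^m x₀
  have hc : ContMDiffAt (𝓡 m) (𝓡 m) ∞ c.symm y := contMDiffAt_chartAt_symm hy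
  have hfd : MDifferentiableAt (𝓡 m) (𝓡 m) f (c.symm y) := hf.mdifferentiableAt (by simp)
  have hv : adjunction (f (c.symm y)) v = 0 := LinearMap.mem_ker.1 hcrit
  have hu : adjunction (c.symm y) u = 0 := by
    ext Z
    rw [adjunction_comp hfd huv, hv]
    rfl
  have hessian_u := fderiv_fderiv_comp_eq_hessian u.toSmooth.contMDiff hc hu ξ η
  have hessian_v := fderiv_fderiv_comp_eq_hessian (ψ := f ∘ c.symm) v.toSmooth.contMDiff
    (hf.comp y hc) hv ξ η
  have hcomp : (u : M → ℝ) ∘ c.symm = (v : M → ℝ) ∘ (f ∘ c.symm) :=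
    funext fun z => huv (c.symm z)
  have hchain : mfderiv (𝓡 m) (𝓡 m) (f ∘ c.symm) y =
      (mfderiv (𝓡 m) (𝓡 m) f (c.symm y)).comp (mfderiv (𝓡 m) (𝓡 m) c.symm y) :=
    mfderiv_comp y hfd (hc.mdifferentiableAt (by simp))
  rw [hchain] at hessian_v
  rw [hcomp] at hessian_u
  exact hessian_u.symm.trans hessian_v

variable [RiemannianBundle (fun x : M => TangentSpace (𝓡 m) x)] {f : M → M} {x : M}
  {ρ : SampleSpace V h ≃ₗᵢ[ℝ] SampleSpace V h}
  (D : TangentSpace (𝓡 m) x ≃ₗᵢ[ℝ] TangentSpace (𝓡 m) (f x))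

theorem mem_kernelSpace_iff_of_adjunction_comp
    (hadj : ∀ v X, adjunction x (ρ v) X = adjunction (f x) v (D X)) (v : SampleSpace V h) :
    ρ v ∈ kernelSpace V h x ↔ v ∈ kernelSpace V h (f x) := by
  simp only [kernelSpace, LinearMap.mem_ker]
  constructor <;> intro hv <;> ext Y
  · obtain ⟨X, rfl⟩ := D.surjective Y
    rw [← hadj, hv]
    rfl
  · rw [hadj, hv]
    rfl

theorem det_hessianOperator_eq {f₁ f₂ : M → ℝ} {x₁ x₂ : M}
    (D : TangentSpace (𝓡 m) x₁ ≃ₗᵢ[ℝ] TangentSpace (𝓡 m) x₂)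
    (hD : ∀ X Y, hessian (m := m) f₁ x₁ X Y = hessian (m := m) f₂ x₂ (D X) (D Y)) :
    (hessianOperator (m := m) f₁ x₁).det = (hessianOperator (m := m) f₂ x₂).det := by
  have hconj : (hessianOperator (m := m) f₂ x₂).toLinearMap = D.toLinearEquiv.toLinearMap ∘ₗ
      (hessianOperator (m := m) f₁ x₁).toLinearMap ∘ₗ D.toLinearEquiv.symm.toLinearMap := by
    ext X : 1
    refine ext_inner_right ℝ fun Y => ?_
    obtain ⟨X, rfl⟩ := D.surjective X
    obtain ⟨Y, rfl⟩ := D.surjective Y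
    have hinner : ⟪hessianOperator (m := m) f₂ x₂ (D X), D Y⟫_ℝ =
        ⟪D (hessianOperator (m := m) f₁ x₁ X), D Y⟫_ℝ := by
      rw [D.inner_map_map, hessianOperator, hessianOperator, inner_operatorOfBilin,
        inner_operatorOfBilin, hD]
    simpa using hinner
  rw [ContinuousLinearMap.det, ContinuousLinearMap.det, hconj, LinearMap.det_conj]

variable [FiniteDimensional ℝ V]

theorem hessianAverage_comp
    (hadj : ∀ v X, adjunction x (ρ v) X = adjunction (f x) v (D X))
    (hhess : ∀ v ∈ kernelSpace V h (f x), ∀ X Y, hessian (m := m) (ρ v).toSmooth x X Y =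
      hessian (m := m) v.toSmooth (f x) (D X) (D Y)) :
    hessianAverage V h x = hessianAverage V h (f x) := by
  have hker : (kernelSpace V h (f x)).map ρ.toLinearEquiv.toLinearMap = kernelSpace V h x := by
    ext u
    obtain ⟨v, rfl⟩ := ρ.surjective u
    exact ρ.injective.mem_set_image.trans (mem_kernelSpace_iff_of_adjunction_comp D hadj v).symm
  let e : kernelSpace V h (f x) ≃ₗᵢ[ℝ] kernelSpace V h x :=
    (ρ.submoduleMap (kernelSpace V h (f x))).trans (LinearIsometryEquiv.ofEq _ _ hker)
  rw [hessianAverage, hessianAverage,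
    ← (measurePreserving_sphereEquiv e).integral_comp (sphereEquiv e).measurableEmbedding]
  exact integral_congr_ae (Filter.Eventually.of_forall fun v =>
    congrArg abs (det_hessianOperator_eq D (hhess _ v.1.2)))

theorem jacobian_dualAdjunction_comp
    (hadj : ∀ v X, adjunction x (ρ v) X = adjunction (f x) v (D X)) :
    jacobian (dualAdjunction (V := V) (h := h) x) =
      jacobian (dualAdjunction (V := V) (h := h) (f x)) := by
  have hdual (X : TangentSpace (𝓡 m) x) :
      dualAdjunction x X = ρ (dualAdjunction (f x) (D X)) := by
    refine ext_inner_right ℝ fun u => ?_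
    obtain ⟨v, rfl⟩ := ρ.surjective u
    rw [inner_dualAdjunction, hadj, ρ.inner_map_map, inner_dualAdjunction]
  rw [jacobian_eq ((stdOrthonormalBasis ℝ (TangentSpace (𝓡 m) x)).map D), jacobian]
  simp only [Matrix.gram, hdual, ρ.inner_map_map, OrthonormalBasis.map_apply]

theorem criticalDensity_comp [IsManifold (𝓡 m) ∞ M] (hf : ContMDiffAt (𝓡 m) (𝓡 m) ∞ f x)
    (hD : ∀ X, D X = mfderiv (𝓡 m) (𝓡 m) f x X) (hρ : ∀ v z, ρ v z = v (f z)) :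
    criticalDensity V h x = criticalDensity V h (f x) := by
  have hadj (v : SampleSpace V h) (X : TangentSpace (𝓡 m) x) :
      adjunction x (ρ v) X = adjunction (f x) v (D X) := by
    rw [adjunction_comp (hf.mdifferentiableAt (by simp)) (hρ v), hD]
  have hhess (v : SampleSpace V h) (hv : v ∈ kernelSpace V h (f x))
      (X Y : TangentSpace (𝓡 m) x) : hessian (m := m) (ρ v).toSmooth x X Y =
        hessian (m := m) v.toSmooth (f x) (D X) (D Y) := by
    rw [hessian_comp hf (hρ v) hv, hD, hD]
  rw [criticalDensity, criticalDensity, hessianAverage_comp D hadj hhess,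
    jacobian_dualAdjunction_comp D hadj]

end Pullback

section Homogeneous

variable {m : ℕ} {M : Type*} [TopologicalSpace M] [ChartedSpace ℝ^m M]
  {V : Submodule ℝ C^∞⟮𝓡 m, M; ℝ⟯} {h : InnerProductSpace.Core ℝ V}
  [RiemannianBundle (fun x : M => TangentSpace (𝓡 m) x)] {G : Type*} [Group G] [MulAction G M]

theorem IsHomogeneous.exists_mfderiv_linearIsometryEquiv (hG : IsHomogeneous V h G) (a : G)
    (x : M) :
    ∃ D : TangentSpace (𝓡 m) x ≃ₗᵢ[ℝ] TangentSpace (𝓡 m) (a • x),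
      ∀ X, D X = mfderiv (𝓡 m) (𝓡 m) (fun z : M => a • z) x X :=
  ⟨((mfderiv (𝓡 m) (𝓡 m) (fun z : M => a • z) x).toLinearMap.isometryOfInner
    (hG.isometric a x)).toLinearIsometryEquiv rfl, fun _ => rfl⟩

variable [FiniteDimensional ℝ V]

theorem IsHomogeneous.exists_pullback_linearIsometryEquiv (hG : IsHomogeneous V h G) (a : G) :
    ∃ ρ : SampleSpace V h ≃ₗᵢ[ℝ] SampleSpace V h, ∀ v x, ρ v x = v (a • x) := by
  choose ρ hρ using hG.pullback_mem a
  have hext {u v : SampleSpace V h} (huv : ∀ x, u x = v x) : u = v :=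
    Subtype.ext (ContMDiffMap.ext huv)
  let L : SampleSpace V h →ₗ[ℝ] SampleSpace V h :=
    { toFun := ρ
      map_add' := fun u v => hext fun x => by
        simp only [hρ, SampleSpace.coe_add, Pi.add_apply]
      map_smul' := fun c v => hext fun x => by
        simp only [hρ, SampleSpace.coe_smul, Pi.smul_apply, RingHom.id_apply] }
  exact ⟨(L.isometryOfInner fun u v =>
    hG.inner_pullback a u v (ρ u) (ρ v) (hρ u) (hρ v)).toLinearIsometryEquiv rfl, hρ⟩

variable [IsManifold (𝓡 m) ∞ M]

theorem criticalDensity_eq_of_isHomogeneous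
    (hsmooth : ∀ a : G, ContMDiff (𝓡 m) (𝓡 m) ∞ fun z : M => a • z)
    (hG : IsHomogeneous V h G) (x y : M) : criticalDensity V h x = criticalDensity V h y := by
  obtain ⟨a, rfl⟩ := hG.transitive x y
  obtain ⟨ρ, hρ⟩ := hG.exists_pullback_linearIsometryEquiv a
  obtain ⟨D, hD⟩ := hG.exists_mfderiv_linearIsometryEquiv a x
  exact criticalDensity_comp D (hsmooth a x) hD hρ

theorem expectation_eq_of_criticalDensity_eq [CompactSpace M] [MeasurableSpace M] [BorelSpace M]
    [IsContinuousRiemannianBundle ℝ^m (fun x : M => TangentSpace (𝓡 m) x)] (hV : IsAmple V h)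
    {x₀ : M} (hconst : ∀ x, criticalDensity V h x = criticalDensity V h x₀) :
    expectation V h =
      ENNReal.ofReal (criticalDensity V h x₀ / sigma (Module.finrank ℝ V - 1)) *
        riemannianVolume m M Set.univ := by
  have hdensity : criticalDensity V h = fun _ => criticalDensity V h x₀ := funext hconst
  have hint := integrable_criticalDensity hV
  rw [hdensity] at hint
  rw [expectation_eq hV, hdensity, integral_const, smul_eq_mul]
  rcases integrable_const_iff.1 hint with hzero | hfinite
  · simp only [hzero, mul_zero, zero_div, ENNReal.ofReal_zero, zero_mul]
  · rw [← ofReal_measureReal (μ := riemannianVolume m M) (s := Set.univ),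
      ← ENNReal.ofReal_mul (div_nonneg (criticalDensity_nonneg x₀) (sigma_pos _).le)]
    congr 1
    ring

end Homogeneous

theorem isContinuousRiemannianBundle_of_isContMDiff {m : ℕ} {M : Type*} [TopologicalSpace M]
    [ChartedSpace ℝ^m M] [IsManifold (𝓡 m) ∞ M]
    [RiemannianBundle (fun x : M => TangentSpace (𝓡 m) x)]
    [IsContMDiffRiemannianBundle (𝓡 m) ∞ ℝ^m (fun x : M => TangentSpace (𝓡 m) x)] :
    IsContinuousRiemannianBundle ℝ^m (fun x : M => TangentSpace (𝓡 m) x) := by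
  obtain ⟨g, hg, hinner⟩ := IsContMDiffRiemannianBundle.exists_contMDiff (IB := 𝓡 m) (n := ∞)
    (F := ℝ^m) (E := fun x : M => TangentSpace (𝓡 m) x)
  exact ⟨g, hg.continuous, hinner⟩

end CriticalSets

end

theorem corollary1p4_general {m : ℕ} {M : Type*} [TopologicalSpace M] [CompactSpace M]
    [ChartedSpace (EuclideanSpace ℝ (Fin m)) M] [IsManifold (𝓡 m) ∞ M]
    [MeasurableSpace M] [BorelSpace M]
    [RiemannianBundle (fun x : M => TangentSpace (𝓡 m) x)]
    [IsContinuousRiemannianBundle (EuclideanSpace ℝ (Fin m))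
      (fun x : M => TangentSpace (𝓡 m) x)]
    (V : Submodule ℝ C^∞⟮𝓡 m, M; ℝ⟯) [FiniteDimensional ℝ V]
    (h : InnerProductSpace.Core ℝ V) (hV : CriticalSets.IsAmple V h) :
    AEMeasurable (fun v : sphere (0 : CriticalSets.SampleSpace V h) 1 =>
        CriticalSets.criticalCount (v : CriticalSets.SampleSpace V h))
      (CriticalSets.sphereArea (CriticalSets.SampleSpace V h)) ∧
    Integrable (CriticalSets.criticalDensity V h) (CriticalSets.riemannianVolume m M) ∧
    CriticalSets.expectation V h =
      ENNReal.ofReal (1 / CriticalSets.sigma (Module.finrank ℝ V - 1) *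
        ∫ x, CriticalSets.criticalDensity V h x ∂(CriticalSets.riemannianVolume m M)) ∧
    ∀ (G : Type*) [Group G] [MulAction G M],
      (∀ a : G, ContMDiff (𝓡 m) (𝓡 m) ∞ fun z : M => a • z) →
      CriticalSets.IsHomogeneous V h G →
        (∀ x y : M, CriticalSets.criticalDensity V h x = CriticalSets.criticalDensity V h y) ∧
        ∀ x₀ : M, CriticalSets.expectation V h =
          ENNReal.ofReal (CriticalSets.criticalDensity V h x₀ /
              CriticalSets.sigma (Module.finrank ℝ V - 1)) *
            CriticalSets.riemannianVolume m M Set.univ := by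
  refine ⟨CriticalSets.aemeasurable_criticalCount hV, CriticalSets.integrable_criticalDensity hV,
    CriticalSets.expectation_eq hV, fun G _ _ hsmooth hG => ?_⟩
  have hconst := CriticalSets.criticalDensity_eq_of_isHomogeneous hsmooth hG
  exact ⟨hconst, fun x₀ =>
    CriticalSets.expectation_eq_of_criticalDensity_eq hV fun x => hconst x x₀⟩

theorem corollary1p4 {m : ℕ} {M : Type*} [TopologicalSpace M] [T2Space M] [CompactSpace M]
    [ConnectedSpace M] [ChartedSpace (EuclideanSpace ℝ (Fin m)) M] [IsManifold (𝓡 m) ∞ M]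
    [MeasurableSpace M] [BorelSpace M]
    -- the Riemannian metric `g`
    [RiemannianBundle (fun x : M => TangentSpace (𝓡 m) x)]
    [IsContMDiffRiemannianBundle (𝓡 m) ∞ (EuclideanSpace ℝ (Fin m))
      (fun x : M => TangentSpace (𝓡 m) x)]
    (V : Submodule ℝ C^∞⟮𝓡 m, M; ℝ⟯) [FiniteDimensional ℝ V]
    (h : InnerProductSpace.Core ℝ V) (hV : CriticalSets.IsAmple V h) :
    AEMeasurable (fun v : sphere (0 : CriticalSets.SampleSpace V h) 1 =>
        CriticalSets.criticalCount (v : CriticalSets.SampleSpace V h))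
      (CriticalSets.sphereArea (CriticalSets.SampleSpace V h)) ∧
    Integrable (CriticalSets.criticalDensity V h) (CriticalSets.riemannianVolume m M) ∧
    CriticalSets.expectation V h =
      ENNReal.ofReal (1 / CriticalSets.sigma (Module.finrank ℝ V - 1) *
        ∫ x, CriticalSets.criticalDensity V h x ∂(CriticalSets.riemannianVolume m M)) ∧
    ∀ (k : ℕ) (G : Type*) [Group G] [TopologicalSpace G] [T2Space G] [CompactSpace G]
      [ChartedSpace (EuclideanSpace ℝ (Fin k)) G] [LieGroup (𝓡 k) ∞ G]
      [MulAction G M] [ContMDiffSMul (𝓡 k) (𝓡 m) ∞ G M],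
      CriticalSets.IsHomogeneous V h G →
        (∀ x y : M, CriticalSets.criticalDensity V h x = CriticalSets.criticalDensity V h y) ∧
        ∀ x₀ : M, CriticalSets.expectation V h =
          ENNReal.ofReal (CriticalSets.criticalDensity V h x₀ /
              CriticalSets.sigma (Module.finrank ℝ V - 1)) *
            CriticalSets.riemannianVolume m M Set.univ := by
  have := CriticalSets.isContinuousRiemannianBundle_of_isContMDiff (m := m) (M := M)
  obtain ⟨hmeasurable, hintegrable, hexpectation, hhomogeneous⟩ := corollary1p4_general V h hV
  refine ⟨hmeasurable, hintegrable, hexpectation, fun k G _ _ _ _ _ _ _ _ => ?_⟩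
  exact hhomogeneous G fun a => ContMDiffSMul.contMDiff_const_smul (I := 𝓡 k) a
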